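/- Let $K(\eta)=e^{\eta^2/4}$ for $\eta\in\mathbb R_+=(0,\infty)$, let $L^2_K(\mathbb R_+)$ be the space of (classes of) measurable functions $\phi$ on $\mathbb R_+$ with $\int_0^\infty\phi^2K\,d\eta<\infty$, and let $H^1_K(\mathbb R_+)$ be the space of $\phi\in L^2_K(\mathbb R_+)$ whose weak derivative $\phi'$ belongs to $L^2_K(\mathbb R_+)$. For $\phi\in H^1_K(\mathbb R_+)$, $\phi(0)$ denotes the value at $0$ of the representative of $\phi$ that is continuous on $[0,\infty)$. Let $p>1$ and consider the problem $$-\omega''-\frac{\eta}{2}\,\omega'-\frac{1}{2(p-1)}\,\omega=0\ \text{ in }\mathbb R_+,\qquad -\omega'(0)+|\omega|^{p-1}\omega(0)=0,\qquad \lim_{\eta\to\infty}\eta^{\frac1{p-1}}\omega(\eta)=0.\tag{1}$$ Let $\mathcal E$ be the set of its weak solutions in $H^1_K(\mathbb R_+)$, that is, of all $\omega\in H^1_K(\mathbb R_+)$ such that $$\int_0^\infty\Big(\omega'\zeta'-\frac{1}{2(p-1)}\,\omega\zeta\Big)K\,d\eta+|\omega(0)|^{p-1}\omega(0)\,\zeta(0)=0\qquad\text{for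 all }\zeta\in H^1_K(\mathbb R_+),$$ and let $\mathcal E_+$ be the set of those $\omega\in\mathcal E$ with $\omega\ge0$ almost everywhere. 1. If $p\ge2$, then $\mathcal E=\{0\}$. 2. If $1<p\le\frac32$, then $\mathcal E_+=\{0\}$. 3. If $\frac32<p<2$, then $\mathcal E=\{\omega_s,-\omega_s,0\}$, where $\omega_s$ (identified with its representative continuous on $[0,\infty)$) is positive on $[0,\infty)$ and is the unique positive solution of (1): it is the only element of $\mathcal E$ that is positive almost everywhere, it is a classical solution of (1), and every classical solution of (1) that is positive on $(0,\infty)$ coincides with it on $[0,\infty)$. Here a classical solution is a function on $[0,\infty)$ that is differentiable on $[0,\infty)$ (one-sidedly at $0$) and twice differentiable on $(0,\infty)$ and satisfies (1). Furthermore, there exists $c>1$ such that $$c^{-1}(1+\eta)^{\frac1{p-1}-1}\le e^{\frac{\eta^2}{4}}\omega_s(\eta)\le c\,(1+\eta)^{\frac1{p-1}-1}\qquad\text{for all }\eta>0.$$ -/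

import Mathlib

open MeasureTheory Set Filter Topology
open scoped ENNReal

noncomputable section

namespace SelfSimilar

/-- The Gaussian weight `K(η) = exp (η² / 4)`. -/
def K (η : ℝ) : ℝ := Real.exp (η ^ 2 / 4)

/-- The measure `K(η) dη` on the half-line `(0, ∞)`. -/
def muK : Measure ℝ :=
  (volume.restrict (Ioi (0 : ℝ))).withDensity (fun η => ENNReal.ofReal (K η))

/-- The weighted space `L²_K(ℝ₊)`, whose elements are classes of functions modulo equality almost
everywhere on `(0, ∞)`. (As `K ≥ 1`, they are automatically locally integrable, and as `K > 0`,
the null sets of `muK` are those of Lebesgue measure on `(0, ∞)`.) -/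
abbrev L2K : Type := Lp ℝ 2 muK

/-- `ψ` is the derivative of `φ` in the sense of distributions on `(0, ∞)`. -/
def IsWeakDeriv (φ ψ : L2K) : Prop :=
  ∀ θ : ℝ → ℝ, ContDiff ℝ (⊤ : ℕ∞) θ → HasCompactSupport θ → tsupport θ ⊆ Ioi (0 : ℝ) →
    ∫ η in Ioi (0 : ℝ), φ η * deriv θ η = -∫ η in Ioi (0 : ℝ), ψ η * θ η

/-- The weighted Sobolev space `H¹_K(ℝ₊)`: the elements of `L²_K(ℝ₊)` with weak derivative
in `L²_K(ℝ₊)`. -/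
def H1K : Set L2K := {φ | ∃ ψ : L2K, IsWeakDeriv φ ψ}

/-- `f` is a representative of the class `φ` that is continuous on `[0, ∞)`. -/
def IsContRep (φ : L2K) (f : ℝ → ℝ) : Prop :=
  ContinuousOn f (Ici (0 : ℝ)) ∧ ∀ᵐ η ∂muK, φ η = f η

/-- The boundary value `φ(0)` is `a`: the value at `0` of the continuous representative. -/
def HasTrace (φ : L2K) (a : ℝ) : Prop := ∃ f : ℝ → ℝ, IsContRep φ f ∧ f 0 = a

/-- The weak formulation, tested against all of `H¹_K(ℝ₊)`:
`∫₀^∞ (ω' ζ' - ω ζ / (2 (p - 1))) K dη + |ω(0)|^(p-1) ω(0) ζ(0) = 0`.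
The weak derivatives `dω`, `dζ` and the boundary values `a = ω(0)`, `b = ζ(0)` are uniquely
determined by `ω` and `ζ`. -/
def IsWeakSolution (p : ℝ) (ω : L2K) : Prop :=
  ∃ (dω : L2K) (a : ℝ), IsWeakDeriv ω dω ∧ HasTrace ω a ∧
    ∀ (ζ dζ : L2K) (b : ℝ), IsWeakDeriv ζ dζ → HasTrace ζ b →
      (∫ η, (dω η * dζ η - 1 / (2 * (p - 1)) * (ω η * ζ η)) ∂muK)
        + |a| ^ (p - 1) * a * b = 0

/-- The set of weak solutions in `H¹_K(ℝ₊)`. -/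
def E (p : ℝ) : Set L2K := {ω | ω ∈ H1K ∧ IsWeakSolution p ω}

/-- The set of nonnegative weak solutions. -/
def EPlus (p : ℝ) : Set L2K := {ω | ω ∈ E p ∧ ∀ᵐ η ∂muK, 0 ≤ ω η}

/-- Classical solutions (only the values of `w` on `[0, ∞)` matter) of
`-w'' - (η/2) w' - w / (2 (p - 1)) = 0` on `(0, ∞)`, `-w'(0) + |w(0)|^(p-1) w(0) = 0`,
`η^(1/(p-1)) w(η) → 0` as `η → ∞`. Here `dw` and `ddw` are the first two derivatives; the
derivative at `0` is the one-sided one. -/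
def IsClassicalSolution (p : ℝ) (w : ℝ → ℝ) : Prop :=
  ∃ dw ddw : ℝ → ℝ,
    (∀ η : ℝ, 0 ≤ η → HasDerivWithinAt w (dw η) (Ici 0) η) ∧
    (∀ η : ℝ, 0 < η → HasDerivAt dw (ddw η) η) ∧
    (∀ η : ℝ, 0 < η → -ddw η - η / 2 * dw η - 1 / (2 * (p - 1)) * w η = 0) ∧
    (-dw 0 + |w 0| ^ (p - 1) * w 0 = 0) ∧
    Tendsto (fun η : ℝ => η ^ (1 / (p - 1)) * w η) atTop (𝓝 0)

end SelfSimilar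

end

/-! Put κ = 1/(2(p-1)). The linear operator is self-adjoint for the weight: (K z')' = -κ K z. The
functions exp(-η²/4) (κ = 1/2, z'(0) = 0) and η exp(-η²/4) (κ = 1, z(0) = 0) solve the equation, and
1/2 and 1 are the first Neumann and Dirichlet eigenvalues. The three cases are κ ≤ 1/2, κ ≥ 1 and
1/2 < κ < 1.

If κ ≤ 1/2, testing a weak solution f with itself and applying the Neumann inequality forces f(0) =
0; the Dirichlet inequality then gives f = 0. Both inequalities come from Picone's identity
(`IsH1.mul_integral_sq_le`).

If κ ≥ 1 and f ≥ 0, testing with the second explicit solution gives f(0) ≤ 0, and testing with the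
first then gives ∫ f exp(-η²/4) K = 0, so f = 0.

If 1/2 < κ < 1, an integral of parabolic cylinder type provides a decaying solution z with z > 0 and
z'(0) > 0 (`exists_pos_decayingSolution`). For a weak solution f, the difference f - (f(0)/z(0)) z
vanishes at 0 and has Rayleigh quotient κ < 1, so it is zero (`ae_eq_mul_of_weak`). For classical
solutions the Wronskian replaces this argument (`IsDecayingSolution.eq_const_mul`). In both settings
the solution is t z, and the boundary condition is a scalar equation for t with exactly three roots.
-/

namespace SelfSimilar

/-! ### Absolutely continuous functions on the half-line -/

/-- `f` is absolutely continuous on every `[0, R]`, with derivative `f'` almost everywhere. -/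
structure ACDeriv (f f' : ℝ → ℝ) : Prop where
  ac : ∀ R, 0 ≤ R → AbsolutelyContinuousOnInterval f 0 R
  ae_hasDerivAt : ∀ᵐ x ∂volume.restrict (Ioi (0 : ℝ)), HasDerivAt f (f' x) x

theorem ACDeriv.of_hasDerivAt {f f' : ℝ → ℝ} (h : ∀ x, 0 ≤ x → HasDerivAt f (f' x) x)
    (hc : ContinuousOn f' (Ici 0)) : ACDeriv f f' where
  ac R hR := by
    obtain ⟨C, hC⟩ := isCompact_Icc.exists_bound_of_continuousOn
      (hc.mono (Icc_subset_Ici_self : Icc 0 R ⊆ Ici 0))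
    have hL : LipschitzOnWith (Real.toNNReal C) f (Icc 0 R) :=
      (convex_Icc 0 R).lipschitzOnWith_of_nnnorm_hasDerivWithin_le
        (fun x hx => (h x hx.1).hasDerivWithinAt) fun x hx => by
          rw [← NNReal.coe_le_coe, coe_nnnorm]
          exact (hC x hx).trans (Real.le_coe_toNNReal C)
    exact LipschitzOnWith.absolutelyContinuousOnInterval (by rwa [uIcc_of_le hR])
  ae_hasDerivAt := (ae_restrict_mem measurableSet_Ioi).mono fun x hx => h x (le_of_lt hx)

theorem ACDeriv.mul {f f' g g' : ℝ → ℝ} (hf : ACDeriv f f') (hg : ACDeriv g g') :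
    ACDeriv (fun x => f x * g x) (fun x => f' x * g x + f x * g' x) where
  ac R hR := (hf.ac R hR).fun_mul (hg.ac R hR)
  ae_hasDerivAt := by filter_upwards [hf.ae_hasDerivAt, hg.ae_hasDerivAt] with x h1 h2 using h1.mul h2

theorem ACDeriv.continuousOn {f f' : ℝ → ℝ} (hf : ACDeriv f f') : ContinuousOn f (Ici 0) := by
  intro x hx
  have hx0 : (0 : ℝ) ≤ x := hx
  have h := (hf.ac (x + 1) (by linarith)).continuousOn
  rw [uIcc_of_le (by linarith : (0 : ℝ) ≤ x + 1)] at h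
  refine (h x ⟨hx0, by linarith⟩).mono_of_mem_nhdsWithin ?_
  rw [← Ici_inter_Iic]
  exact inter_mem self_mem_nhdsWithin (mem_nhdsWithin_of_mem_nhds (Iic_mem_nhds (by linarith)))

theorem ACDeriv.ae_eq_deriv {f f' : ℝ → ℝ} (hf : ACDeriv f f') (R : ℝ) :
    deriv f =ᵐ[volume.restrict (Ioc 0 R)] f' := by
  have := ae_restrict_of_ae_restrict_of_subset (Ioc_subset_Ioi_self : Ioc 0 R ⊆ Ioi 0) hf.ae_hasDerivAt
  filter_upwards [this] with x hx using hx.deriv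

theorem ACDeriv.intervalIntegrable {f f' : ℝ → ℝ} (hf : ACDeriv f f') {R : ℝ} (hR : 0 ≤ R) :
    IntervalIntegrable f' volume 0 R := by
  have h := (hf.ac R hR).intervalIntegrable_deriv
  rw [intervalIntegrable_iff_integrableOn_Ioc_of_le hR] at h ⊢
  exact h.congr (hf.ae_eq_deriv R)

theorem ACDeriv.integral_eq_sub {f f' : ℝ → ℝ} (hf : ACDeriv f f') {R : ℝ} (hR : 0 ≤ R) :
    ∫ x in (0 : ℝ)..R, f' x = f R - f 0 := by
  rw [← (hf.ac R hR).integral_deriv_eq_sub, intervalIntegral.integral_of_le hR,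
    intervalIntegral.integral_of_le hR]
  exact integral_congr_ae (hf.ae_eq_deriv R).symm

theorem ACDeriv.tendsto {f f' : ℝ → ℝ} (hf : ACDeriv f f') (hf' : IntegrableOn f' (Ioi 0)) :
    Tendsto f atTop (𝓝 (f 0 + ∫ x in Ioi (0 : ℝ), f' x)) := by
  have h := (intervalIntegral_tendsto_integral_Ioi 0 hf' tendsto_id).const_add (f 0)
  refine h.congr' ?_
  filter_upwards [eventually_ge_atTop 0] with R hR
  rw [id, hf.integral_eq_sub hR]; ring

/-- Otherwise h(R) ≥ ε/R for all large R, and 1/R is not integrable at infinity. This supplies the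
sequence of radii along which boundary terms vanish. -/
theorem frequently_mul_lt_of_integrableOn {h : ℝ → ℝ} (hi : IntegrableOn h (Ioi 0)) {ε : ℝ}
    (hε : 0 < ε) : ∃ᶠ R in atTop, R * h R < ε := by
  intro hcon
  obtain ⟨A, hA⟩ := eventually_atTop.1 hcon
  set B := max A 1
  have hB : 0 < B := lt_of_lt_of_le one_pos (le_max_right _ _)
  refine not_integrableOn_Ioi_inv (a := B) ?_
  refine ((hi.mono_set (Ioi_subset_Ioi hB.le)).const_mul ε⁻¹).mono'
    measurable_inv.aestronglyMeasurable ?_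
  filter_upwards [ae_restrict_mem measurableSet_Ioi] with x hx
  have hx' : B < x := hx
  have hx0 : 0 < x := hB.trans hx'
  have := hA x ((le_max_left _ _).trans hx'.le)
  rw [Real.norm_of_nonneg (by positivity), inv_mul_eq_div, le_div_iff₀ hε, inv_mul_eq_div,
    div_le_iff₀ hx0]
  linarith

/-- Integrability of f' gives f a limit at infinity, and integrability of f makes that limit zero.
-/
theorem ACDeriv.integral_Ioi_of_integrableOn {f f' : ℝ → ℝ} (hf : ACDeriv f f')
    (hi : IntegrableOn f (Ioi 0)) (hf' : IntegrableOn f' (Ioi 0)) :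
    ∫ x in Ioi (0 : ℝ), f' x = -f 0 := by
  have ht := hf.tendsto hf'
  set L := f 0 + ∫ x in Ioi (0 : ℝ), f' x with hL
  suffices L = 0 by linarith
  by_contra hne
  have hpos : 0 < |L| / 2 := by positivity
  have h1 : ∀ᶠ R in atTop, |L| / 2 < |f R| :=
    ht.abs.eventually (lt_mem_nhds (by linarith [abs_pos.2 hne]))
  obtain ⟨R, hR1, hR2, hR3⟩ := ((frequently_mul_lt_of_integrableOn hi.abs hpos).and_eventually
    (h1.and (eventually_ge_atTop 1))).exists
  nlinarith [abs_nonneg (f R)]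

/-! ### The weighted measure and its L² space -/

theorem K_pos (η : ℝ) : 0 < K η := Real.exp_pos _

theorem continuous_K : Continuous K := by unfold K; fun_prop

theorem measurable_ofReal_K : Measurable fun η => ENNReal.ofReal (K η) :=
  continuous_K.measurable.ennreal_ofReal

theorem ae_muK : ae muK = ae (volume.restrict (Ioi (0 : ℝ))) := by
  ext s
  change (∀ᵐ x ∂muK, x ∈ s) ↔ ∀ᵐ x ∂volume.restrict (Ioi (0 : ℝ)), x ∈ s
  rw [muK, ae_withDensity_iff measurable_ofReal_K]
  simp [K_pos]

theorem integral_muK (F : ℝ → ℝ) : ∫ η, F η ∂muK = ∫ η in Ioi (0 : ℝ), K η * F η := by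
  rw [muK, integral_withDensity_eq_integral_toReal_smul measurable_ofReal_K
    (ae_of_all _ fun _ => ENNReal.ofReal_lt_top)]
  simp [ENNReal.toReal_ofReal (K_pos _).le]

theorem integrable_muK_iff (F : ℝ → ℝ) :
    Integrable F muK ↔ IntegrableOn (fun η => K η * F η) (Ioi 0) := by
  rw [muK, integrable_withDensity_iff_integrable_smul' measurable_ofReal_K
    (ae_of_all _ fun _ => ENNReal.ofReal_lt_top), IntegrableOn]
  simp [ENNReal.toReal_ofReal (K_pos _).le]

theorem aestronglyMeasurable_muK_iff (F : ℝ → ℝ) :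
    AEStronglyMeasurable F muK ↔ AEStronglyMeasurable F (volume.restrict (Ioi 0)) := by
  have h1 : muK ≪ volume.restrict (Ioi 0) := ae_muK.le.absolutelyContinuous_of_ae
  have h2 : volume.restrict (Ioi 0) ≪ muK := ae_muK.ge.absolutelyContinuous_of_ae
  exact ⟨fun h => h.mono_ac h2, fun h => h.mono_ac h1⟩

theorem memLp_muK_iff (F : ℝ → ℝ) :
    MemLp F 2 muK ↔ AEStronglyMeasurable F (volume.restrict (Ioi 0)) ∧
      IntegrableOn (fun η => K η * F η ^ 2) (Ioi 0) := by
  rw [← integrable_muK_iff, ← aestronglyMeasurable_muK_iff]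
  exact ⟨fun h => ⟨h.1, (memLp_two_iff_integrable_sq h.1).1 h⟩,
    fun h => (memLp_two_iff_integrable_sq h.1).2 h.2⟩

theorem memLp_muK_of_bound {z : ℝ → ℝ} (hz : Continuous z) {C : ℝ}
    (h : ∀ η, 0 < η → |z η| ≤ C * (1 + η ^ 2) * Real.exp (-η ^ 2 / 4)) : MemLp z 2 muK := by
  refine (memLp_muK_iff z).2 ⟨hz.aestronglyMeasurable, ?_⟩
  have e (n : ℕ) : IntegrableOn (fun η : ℝ => η ^ (n : ℝ) * Real.exp (-(1 / 4) * η ^ 2)) (Ioi 0) :=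
    integrableOn_rpow_mul_exp_neg_mul_sq (by norm_num)
      (by have : (0 : ℝ) ≤ n := n.cast_nonneg
          linarith)
  have hi : IntegrableOn (fun η : ℝ => C ^ 2 * ((1 + η ^ 2) ^ 2 * Real.exp (-(1 / 4) * η ^ 2)))
      (Ioi 0) := by
    refine Integrable.const_mul ?_ _
    refine (((e 0).add ((e 2).const_mul 2)).add (e 4)).congr (ae_of_all _ fun η => ?_)
    simp only [Pi.add_apply, Real.rpow_natCast]
    ring
  refine hi.mono' (continuous_K.mul (hz.pow 2)).aestronglyMeasurable ?_
  filter_upwards [ae_restrict_mem measurableSet_Ioi] with η hη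
  rw [Real.norm_of_nonneg (mul_nonneg (K_pos η).le (sq_nonneg _))]
  have h1 : z η ^ 2 ≤ (C * (1 + η ^ 2) * Real.exp (-η ^ 2 / 4)) ^ 2 := by
    rw [← sq_abs]; exact pow_le_pow_left₀ (abs_nonneg _) (h η hη) 2
  refine (mul_le_mul_of_nonneg_left h1 (K_pos η).le).trans (le_of_eq ?_)
  have h2 : K η * Real.exp (-η ^ 2 / 4) ^ 2 = Real.exp (-(1 / 4) * η ^ 2) := by
    rw [K, sq (Real.exp _), ← Real.exp_add, ← Real.exp_add]; congr 1; ring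
  rw [← h2]; ring

theorem integrableOn_of_memLp_muK {F : ℝ → ℝ} (hF : MemLp F 2 muK) :
    IntegrableOn F (Ioi 0) := by
  obtain ⟨hm, hi⟩ := (memLp_muK_iff F).1 hF
  have hG : Integrable (fun η : ℝ => Real.exp (-(1 / 4) * η ^ 2)) :=
    integrable_exp_neg_mul_sq (by norm_num)
  refine (hi.add hG.integrableOn).mono' hm (ae_of_all _ fun η => ?_)
  have h2 : K η * Real.exp (-(1 / 4) * η ^ 2) = 1 := by
    rw [K, ← Real.exp_add, Real.exp_eq_one_iff]; ring
  have h3 := Real.exp_pos (-(1 / 4) * η ^ 2)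
  set k := K η
  -- Since K e = 1, completing the square in K|F| shows |F| ≤ K F² + e.
  set e := Real.exp (-(1 / 4) * η ^ 2)
  have hk : 0 < k := K_pos η
  rw [Real.norm_eq_abs, Pi.add_apply, ← sq_abs]
  set y := |F η|
  have : k * (k * y ^ 2 + e - y) = (k * y - 1 / 2) ^ 2 + 3 / 4 := by linear_combination h2
  by_contra hcon
  nlinarith [sq_nonneg (k * y - 1 / 2)]

/-! ### Weak derivatives and absolutely continuous representatives -/

/-- `f` is absolutely continuous and, together with its derivative `f'`, it belongs
to `L²_K(ℝ₊)`. -/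
structure IsH1 (f f' : ℝ → ℝ) : Prop extends ACDeriv f f' where
  memLp : MemLp f 2 muK
  memLp' : MemLp f' 2 muK

theorem integral_mul_deriv_of_test {f f' θ : ℝ → ℝ} (hf : ACDeriv f f')
    (hf1 : IntegrableOn f' (Ioi 0)) (hθ : ContDiff ℝ (⊤ : ℕ∞) θ) (hc : HasCompactSupport θ)
    (hs : tsupport θ ⊆ Ioi (0 : ℝ)) :
    ∫ η in Ioi (0 : ℝ), f η * deriv θ η = -∫ η in Ioi (0 : ℝ), f' η * θ η := by
  have hθd : ∀ x, HasDerivAt θ (deriv θ x) x := fun x =>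
    (hθ.differentiable (by simp) x).hasDerivAt
  have hθ'c : Continuous (deriv θ) := hθ.continuous_deriv (by simp)
  have hP := hf.mul (ACDeriv.of_hasDerivAt (fun x _ => hθd x) hθ'c.continuousOn)
  obtain ⟨R, hR⟩ := (hc.isCompact.isBounded).subset_closedBall 0
  have hz : ∀ x, |R| + 1 ≤ x → θ x = 0 := fun x hx => by
    by_contra hne
    have := hR (subset_tsupport θ hne)
    rw [mem_closedBall_zero_iff, Real.norm_eq_abs] at this
    linarith [le_abs_self x, le_abs_self R]
  have hz' : ∀ x, |R| + 1 ≤ x → deriv θ x = 0 := fun x hx => by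
    by_contra hne
    have := hR (support_deriv_subset hne)
    rw [mem_closedBall_zero_iff, Real.norm_eq_abs] at this
    linarith [le_abs_self x, le_abs_self R]
  have h0 : θ 0 = 0 := by
    by_contra hne
    exact lt_irrefl (0 : ℝ) (hs (subset_tsupport θ hne))
  have i1 : IntegrableOn (fun x => f' x * θ x) (Ioi 0) := by
    obtain ⟨C, hC⟩ := hθ.continuous.bounded_above_of_compact_support hc
    exact hf1.mul_bdd (c := C) hθ.continuous.aestronglyMeasurable (ae_of_all _ hC)
  have i2 : IntegrableOn (fun x => f x * deriv θ x) (Ioi 0) := by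
    have hcI : IntegrableOn (fun x => f x * deriv θ x) (Icc 0 (|R| + 1)) :=
      ((hf.continuousOn.mono Icc_subset_Ici_self).mul hθ'c.continuousOn).integrableOn_Icc
    refine (hcI.mono_set Ioc_subset_Icc_self).of_forall_sdiff_eq_zero measurableSet_Ioi ?_
    intro x hx
    have : |R| + 1 ≤ x := by
      by_contra hlt
      exact hx.2 ⟨hx.1, by linarith⟩
    simp [hz' x this]
  have ht := hP.tendsto (i1.add i2)
  have ht0 : Tendsto (fun x => f x * θ x) atTop (𝓝 0) := by
    refine tendsto_const_nhds.congr' ?_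
    filter_upwards [eventually_ge_atTop (|R| + 1)] with x hx
    simp [hz x hx]
  have := tendsto_nhds_unique ht ht0
  simp only [h0, mul_zero, zero_add] at this
  rw [integral_add i1 i2] at this
  linarith

/-- The fundamental lemma of du Bois-Reymond on the half-line. -/
theorem ae_eq_const_of_integral_mul_deriv_eq_zero {g : ℝ → ℝ}
    (hg : LocallyIntegrableOn g (Ioi 0))
    (h : ∀ θ : ℝ → ℝ, ContDiff ℝ (⊤ : ℕ∞) θ → HasCompactSupport θ → tsupport θ ⊆ Ioi (0 : ℝ) →
      ∫ η in Ioi (0 : ℝ), g η * deriv θ η = 0) :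
    ∃ c : ℝ, ∀ᵐ x ∂volume.restrict (Ioi (0 : ℝ)), g x = c := by
  have hint : ∀ k : ℝ → ℝ, Continuous k → HasCompactSupport k → tsupport k ⊆ Ioi (0 : ℝ) →
      IntegrableOn (fun x => g x * k x) (Ioi 0) := by
    intro k hk hkc hks
    have h1 : IntegrableOn (fun x => g x * k x) (tsupport k) :=
      (hg.integrableOn_compact_subset hks hkc.isCompact).mul_continuousOn hk.continuousOn
        hkc.isCompact
    refine h1.of_forall_sdiff_eq_zero measurableSet_Ioi fun x hx => ?_
    rw [image_eq_zero_of_notMem_tsupport hx.2, mul_zero]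
  -- A test function of zero mean has a compactly supported primitive, so the hypothesis applies to
  -- that primitive.
  have hzero : ∀ k : ℝ → ℝ, ContDiff ℝ (⊤ : ℕ∞) k → HasCompactSupport k →
      tsupport k ⊆ Ioi (0 : ℝ) → ∫ x, k x = 0 → ∫ η in Ioi (0 : ℝ), g η * k η = 0 := by
    intro k hk hkc hks hk0
    have hki : Integrable k := hk.continuous.integrable_of_hasCompactSupport hkc
    obtain ⟨a, b, ha, hab⟩ : ∃ a b : ℝ, 0 < a ∧ tsupport k ⊆ Icc a b := by
      rcases (tsupport k).eq_empty_or_nonempty with he | hne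
      · exact ⟨1, 1, one_pos, by simp [he]⟩
      · obtain ⟨a, ha⟩ := hkc.isCompact.exists_isLeast hne
        obtain ⟨b, hb⟩ := hkc.isCompact.exists_isGreatest hne
        exact ⟨a, b, hks ha.1, fun x hx => ⟨ha.2 hx, hb.2 hx⟩⟩
    have hkz : ∀ x, x ∉ Icc a b → k x = 0 := fun x hx =>
      image_eq_zero_of_notMem_tsupport fun hx' => hx (hab hx')
    set θ : ℝ → ℝ := fun x => ∫ t in Iic x, k t with hθ
    have hθd : ∀ x, HasDerivAt θ (k x) x := by
      intro x
      have h1 : θ = fun x => (∫ t in Iic 0, k t) + ∫ t in (0 : ℝ)..x, k t := by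
        funext y
        rw [← intervalIntegral.integral_Iic_sub_Iic hki.integrableOn hki.integrableOn]
        ring
      rw [h1]
      exact (intervalIntegral.integral_hasDerivAt_right (hki.intervalIntegrable)
        (hk.continuous.stronglyMeasurableAtFilter _ _) hk.continuous.continuousAt).const_add _
    have hderiv : deriv θ = k := funext fun x => (hθd x).deriv
    have hθz : ∀ x, x ∉ Icc a b → θ x = 0 := by
      intro x hx
      rcases lt_or_ge x a with hxa | hxa
      · exact setIntegral_eq_zero_of_forall_eq_zero fun t ht => hkz t fun h' =>
          absurd (h'.1.trans ht) (not_le.2 hxa)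
      · have hxb : b < x := by
          by_contra hcon
          exact hx ⟨hxa, not_lt.1 hcon⟩
        change ∫ t in Iic x, k t = 0
        rw [setIntegral_eq_integral_of_forall_compl_eq_zero, hk0]
        intro t ht
        exact hkz t fun h' => ht (h'.2.trans hxb.le)
    have hts : tsupport θ ⊆ Icc a b := closure_minimal
      (fun x hx => by by_contra hcon; exact hx (hθz x hcon)) isClosed_Icc
    have hsm : ContDiff ℝ (⊤ : ℕ∞) θ := by
      rw [contDiff_infty_iff_deriv, hderiv]
      exact ⟨fun x => (hθd x).differentiableAt, hk⟩
    have := h θ hsm (isCompact_Icc.of_isClosed_subset (isClosed_tsupport θ) hts)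
      (hts.trans fun x hx => ha.trans_le hx.1)
    rwa [hderiv] at this
  -- A bump of unit mass supported in [1, 3], away from 0; subtracting a multiple of it brings any
  -- test function to zero mean.
  let B : ContDiffBump (2 : ℝ) := ⟨1 / 2, 1, by norm_num, by norm_num⟩
  set θ₀ : ℝ → ℝ := B.normed volume
  have hB1 : ContDiff ℝ (⊤ : ℕ∞) θ₀ := B.contDiff_normed
  have hB2 : HasCompactSupport θ₀ := B.hasCompactSupport_normed
  have hB3 : tsupport θ₀ ⊆ Ioi (0 : ℝ) := by
    rw [B.tsupport_normed_eq]
    intro x hx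
    rw [Metric.mem_closedBall, Real.dist_eq] at hx
    have : |x - 2| ≤ 1 := hx
    have := (abs_le.1 this).1
    change 0 < x
    linarith
  have hB4 : ∫ x, θ₀ x = 1 := B.integral_normed
  set c := ∫ η in Ioi (0 : ℝ), g η * θ₀ η
  refine ⟨c, ?_⟩
  have key := isOpen_Ioi.ae_eq_zero_of_integral_contDiff_smul_eq_zero (μ := volume)
    (f := fun x => g x - c) (U := Ioi (0 : ℝ))
    (hg.sub ((locallyIntegrable_const c).locallyIntegrableOn _)) ?_
  · rw [ae_restrict_iff' measurableSet_Ioi]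
    filter_upwards [key] with x hx hx0
    linarith [hx hx0]
  · intro k hk hkc hks
    set m := ∫ x, k x
    have hk' : ContDiff ℝ (⊤ : ℕ∞) k := hk
    have hki : Integrable k := hk.continuous.integrable_of_hasCompactSupport hkc
    have hθi : Integrable θ₀ := hB1.continuous.integrable_of_hasCompactSupport hB2
    have hsub : tsupport (fun x => k x - m * θ₀ x) ⊆ tsupport k ∪ tsupport θ₀ := by
      refine closure_minimal (fun x hx => ?_) ((isClosed_tsupport _).union (isClosed_tsupport _))
      by_contra hcon
      rw [mem_union, not_or] at hcon
      apply hx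
      simp [image_eq_zero_of_notMem_tsupport hcon.1, image_eq_zero_of_notMem_tsupport hcon.2]
    have h1 := hzero (fun x => k x - m * θ₀ x) (hk'.sub (contDiff_const.mul hB1))
      ((hkc.isCompact.union hB2.isCompact).of_isClosed_subset (isClosed_tsupport _) hsub)
      (hsub.trans (union_subset hks hB3))
      (by rw [integral_sub hki (hθi.const_mul m), integral_const_mul, hB4]; ring)
    have h2 : ∫ η in Ioi (0 : ℝ), g η * (k η - m * θ₀ η)
        = (∫ η in Ioi (0 : ℝ), g η * k η) - m * c := by
      rw [← integral_const_mul, ← integral_sub (hint k hk'.continuous hkc hks)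
        ((hint θ₀ hB1.continuous hB2 hB3).const_mul m)]
      congr 1; funext η; ring
    rw [h2] at h1
    have hz : ∀ x, x ∉ Ioi (0 : ℝ) → k x • (g x - c) = 0 := fun x hx => by
      rw [image_eq_zero_of_notMem_tsupport fun h' => hx (hks h'), zero_smul]
    rw [← setIntegral_eq_integral_of_forall_compl_eq_zero hz]
    have hm : ∫ x in Ioi (0 : ℝ), k x = m :=
      setIntegral_eq_integral_of_forall_compl_eq_zero fun x hx =>
        image_eq_zero_of_notMem_tsupport fun h' => hx (hks h')
    have h3 : ∫ x in Ioi (0 : ℝ), k x • (g x - c)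
        = (∫ η in Ioi (0 : ℝ), g η * k η) - c * ∫ x in Ioi (0 : ℝ), k x := by
      rw [← integral_const_mul, ← integral_sub (hint k hk'.continuous hkc hks)
        (hki.integrableOn.const_mul c)]
      congr 1; funext η; simp only [smul_eq_mul]; ring
    rw [h3, hm]; linarith

/-- The primitive of ψ differs from φ by a function with zero weak derivative, hence by a constant.
It is absolutely continuous up to 0 because ψ, being in L²_K, is integrable on the whole half-line.
-/
theorem exists_isH1_of_isWeakDeriv {φ ψ : L2K} (h : IsWeakDeriv φ ψ) :
    ∃ f : ℝ → ℝ, IsContRep φ f ∧ IsH1 f ψ := by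
  have hψ : MemLp ψ 2 muK := Lp.memLp ψ
  have hφ : MemLp φ 2 muK := Lp.memLp φ
  have hψi := integrableOn_of_memLp_muK hψ
  have hφi := integrableOn_of_memLp_muK hφ
  set ψ₀ : ℝ → ℝ := (Ioi (0 : ℝ)).indicator ψ
  have hψ₀ : Integrable ψ₀ := hψi.integrable_indicator measurableSet_Ioi
  set F : ℝ → ℝ := fun x => ∫ t in (0 : ℝ)..x, ψ₀ t with hF
  have hFc : Continuous F := intervalIntegral.continuous_primitive
    (fun a b => hψ₀.intervalIntegrable) 0
  have hFd (c : ℝ) : ACDeriv (fun x => F x + c) ψ := by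
    refine ⟨fun R hR => ?_, ?_⟩
    · have h1 : AbsolutelyContinuousOnInterval F 0 R :=
        IntervalIntegrable.absolutelyContinuousOnInterval_intervalIntegral
          hψ₀.intervalIntegrable left_mem_uIcc
      have h2 : AbsolutelyContinuousOnInterval (fun _ : ℝ => c) 0 R :=
        contDiffOn_const.absolutelyContinuousOnInterval
      exact h1.add h2
    · have := ae_restrict_of_ae (s := Ioi 0) (LocallyIntegrable.ae_hasDerivAt_integral hψ₀.locallyIntegrable)
      filter_upwards [this, ae_restrict_mem measurableSet_Ioi] with x hx hx0
      have h3 := (hx 0).add_const c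
      rwa [show ψ₀ x = ψ x from indicator_of_mem hx0 _] at h3
  have hF0 : ACDeriv F ψ := by simpa using hFd 0
  obtain ⟨c, hc⟩ := ae_eq_const_of_integral_mul_deriv_eq_zero (g := fun x => φ x - F x)
    (hφi.locallyIntegrableOn.sub (hFc.locallyIntegrable.locallyIntegrableOn _)) (by
      intro θ hθ hθc hθs
      have e1 := h θ hθ hθc hθs
      have e2 := integral_mul_deriv_of_test hF0 hψi hθ hθc hθs
      have hθ'c : Continuous (deriv θ) := hθ.continuous_deriv (by simp)
      have i1 : IntegrableOn (fun x => φ x * deriv θ x) (Ioi 0) := by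
        obtain ⟨C, hC⟩ := hθ'c.bounded_above_of_compact_support hθc.deriv
        exact hφi.mul_bdd (c := C) hθ'c.aestronglyMeasurable (ae_of_all _ hC)
      have i2 : IntegrableOn (fun x => F x * deriv θ x) (Ioi 0) :=
        ((hFc.mul hθ'c).integrable_of_hasCompactSupport hθc.deriv.mul_left).integrableOn
      have : ∀ η, (φ η - F η) * deriv θ η = φ η * deriv θ η - F η * deriv θ η :=
        fun η => sub_mul _ _ _
      simp_rw [this]
      rw [integral_sub i1 i2, e1, e2, sub_self])
  have hrep : ∀ᵐ η ∂muK, φ η = F η + c := by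
    rw [ae_muK]
    filter_upwards [hc] with x hx
    linarith
  exact ⟨fun x => F x + c, ⟨(hFc.add continuous_const).continuousOn, hrep⟩,
    hFd c, (memLp_congr_ae hrep).1 hφ, hψ⟩

/-- Continuous functions that agree almost everywhere on the open half-line agree everywhere there,
and so do their limits at 0. The trace is thus well defined. -/
theorem IsContRep.apply_zero_eq {φ : L2K} {f g : ℝ → ℝ} (hf : IsContRep φ f)
    (hg : IsContRep φ g) : f 0 = g 0 := by
  have h : f =ᵐ[volume.restrict (Ioi (0 : ℝ))] g := by
    have h1 := hf.2
    have h2 := hg.2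
    rw [ae_muK] at h1 h2
    filter_upwards [h1, h2] with x hx hx' using hx.symm.trans hx'
  have heq : EqOn f g (Ioi 0) := Measure.eqOn_open_of_ae_eq h isOpen_Ioi
    (hf.1.mono Ioi_subset_Ici_self) (hg.1.mono Ioi_subset_Ici_self)
  have h3 := (hf.1 0 self_mem_Ici).mono_left (nhdsWithin_mono 0 Ioi_subset_Ici_self)
  have h4 := (hg.1 0 self_mem_Ici).mono_left (nhdsWithin_mono 0 Ioi_subset_Ici_self)
  exact tendsto_nhds_unique (h3.congr' (heq.eventuallyEq_of_mem self_mem_nhdsWithin)) h4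

theorem IsH1.isContRep {f f' : ℝ → ℝ} (h : IsH1 f f') : IsContRep (h.memLp.toLp f) f :=
  ⟨h.continuousOn, h.memLp.coeFn_toLp⟩

theorem IsH1.isWeakDeriv {f f' : ℝ → ℝ} (h : IsH1 f f') :
    IsWeakDeriv (h.memLp.toLp f) (h.memLp'.toLp f') := by
  intro θ hθ hθc hθs
  have e1 := h.memLp.coeFn_toLp
  have e2 := h.memLp'.coeFn_toLp
  rw [Filter.EventuallyEq, ae_muK] at e1 e2
  have := integral_mul_deriv_of_test h.toACDeriv (integrableOn_of_memLp_muK h.memLp') hθ hθc hθs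
  convert this using 1
  · exact integral_congr_ae (by filter_upwards [e1] with x hx; rw [hx])
  · congr 1
    exact integral_congr_ae (by filter_upwards [e2] with x hx; rw [hx])

/-! ### Decaying solutions: Green's formula and Picone's identity -/

theorem K_zero : K 0 = 1 := by simp [K]

theorem hasDerivAt_K (x : ℝ) : HasDerivAt K (x / 2 * K x) x := by
  have h : HasDerivAt (fun η : ℝ => η ^ 2 / 4) (x / 2) x := by
    convert! ((hasDerivAt_pow 2 x).div_const 4) using 1
    ring
  convert! h.exp using 1
  rw [K, mul_comm]

/-- `z`, with derivative `z'`, is a solution of `-z'' - (η/2) z' - κ z = 0` that belongs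
to `H¹_K(ℝ₊)`. -/
structure IsDecayingSolution (κ : ℝ) (z z' : ℝ → ℝ) : Prop where
  hasDerivAt : ∀ x, HasDerivAt z (z' x) x
  hasDerivAt' : ∀ x, HasDerivAt z' (-(x / 2 * z' x) - κ * z x) x
  memLp : MemLp z 2 muK
  memLp' : MemLp z' 2 muK

theorem IsDecayingSolution.continuous {κ : ℝ} {z z' : ℝ → ℝ} (h : IsDecayingSolution κ z z') :
    Continuous z := continuous_iff_continuousAt.2 fun x => (h.hasDerivAt x).continuousAt

theorem IsDecayingSolution.continuous' {κ : ℝ} {z z' : ℝ → ℝ} (h : IsDecayingSolution κ z z') :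
    Continuous z' := continuous_iff_continuousAt.2 fun x => (h.hasDerivAt' x).continuousAt

theorem IsDecayingSolution.isH1 {κ : ℝ} {z z' : ℝ → ℝ} (h : IsDecayingSolution κ z z') :
    IsH1 z z' where
  toACDeriv := ACDeriv.of_hasDerivAt (fun x _ => h.hasDerivAt x) h.continuous'.continuousOn
  memLp := h.memLp
  memLp' := h.memLp'

theorem IsDecayingSolution.hasDerivAt_flux {κ : ℝ} {z z' : ℝ → ℝ} (h : IsDecayingSolution κ z z')
    (x : ℝ) : HasDerivAt (fun x => K x * z' x) (-κ * K x * z x) x := by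
  convert! (hasDerivAt_K x).mul (h.hasDerivAt' x) using 1
  ring

theorem IsDecayingSolution.const_mul {κ : ℝ} {z z' : ℝ → ℝ} (h : IsDecayingSolution κ z z')
    (c : ℝ) : IsDecayingSolution κ (fun x => c * z x) (fun x => c * z' x) where
  hasDerivAt x := (h.hasDerivAt x).const_mul c
  hasDerivAt' x := by
    convert! (h.hasDerivAt' x).const_mul c using 1
    ring
  memLp := h.memLp.const_mul c
  memLp' := h.memLp'.const_mul c

/-- Green's formula: integrate (f K z')'. There is no contribution from infinity, since f K z' and
its derivative are integrable by Cauchy–Schwarz in L²_K. -/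
theorem IsH1.integral_mul_decayingSolution {f f' z z' : ℝ → ℝ} {κ : ℝ} (hf : IsH1 f f')
    (hz : IsDecayingSolution κ z z') :
    ∫ η, f' η * z' η ∂muK = κ * ∫ η, f η * z η ∂muK - z' 0 * f 0 := by
  have hG : ACDeriv (fun x => K x * z' x) (fun x => -κ * K x * z x) :=
    ACDeriv.of_hasDerivAt (fun x _ => hz.hasDerivAt_flux x)
      ((continuous_const.mul continuous_K).mul hz.continuous).continuousOn
  have i1 : Integrable (fun x => f' x * z' x) muK := hf.memLp'.integrable_mul hz.memLp'
  have i2 : Integrable (fun x => f x * z x) muK := hf.memLp.integrable_mul hz.memLp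
  have i3 : Integrable (fun x => f x * z' x) muK := hf.memLp.integrable_mul hz.memLp'
  have j1 := (integrable_muK_iff _).1 i1
  have j2 := (integrable_muK_iff _).1 i2
  have j3 := (integrable_muK_iff _).1 i3
  have := (hf.toACDeriv.mul hG).integral_Ioi_of_integrableOn
    (j3.congr (ae_of_all _ fun x => by ring))
    ((j1.add (j2.const_mul (-κ))).congr (ae_of_all _ fun x => by
      simp only [Pi.add_apply]; ring))
  have e : ∀ x, f' x * (K x * z' x) + f x * (-κ * K x * z x)
      = K x * (f' x * z' x) + -κ * (K x * (f x * z x)) := fun x => by ring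
  simp_rw [e] at this
  rw [integral_add j1 (j2.const_mul (-κ)), integral_const_mul, ← integral_muK, ← integral_muK,
    K_zero] at this
  linarith

/-- Picone's identity for a positive solution `z` with `z' / z ≥ -η / 2`. -/
theorem IsH1.mul_integral_sq_le {f f' z z' : ℝ → ℝ} {κ : ℝ} (hf : IsH1 f f')
    (hz : IsDecayingSolution κ z z') (hpos : ∀ x, 0 ≤ x → 0 < z x)
    (hlog : ∀ x, 0 ≤ x → -(x / 2 * z x) ≤ z' x) :
    κ * ∫ η, f η ^ 2 ∂muK ≤ ∫ η, f' η ^ 2 ∂muK + f 0 ^ 2 * (z' 0 / z 0) := by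
  set q : ℝ → ℝ := fun x => z' x / z x with hq
  have hqc : ContinuousOn q (Ici 0) :=
    hz.continuous'.continuousOn.div hz.continuous.continuousOn fun x hx => (hpos x hx).ne'
  -- Riccati equation for q = z'/z in flux form.
  have hG : ACDeriv (fun x => K x * q x) (fun x => -K x * (κ + q x ^ 2)) := by
    refine ACDeriv.of_hasDerivAt (fun x hx => ?_)
      (continuous_K.neg.continuousOn.mul (continuousOn_const.add (hqc.pow 2)))
    have hzx := (hpos x hx).ne'
    have h1 := (hz.hasDerivAt_flux x).div (hz.hasDerivAt x) hzx
    have h2 : (fun x => K x * q x) = fun x => K x * z' x / z x := by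
      funext y; rw [hq]; ring
    rw [h2]
    convert! h1 using 1
    simp only [hq]
    field_simp
    ring
  have hP := (hf.toACDeriv.mul hf.toACDeriv).mul hG
  have j0 := ((memLp_muK_iff _).1 hf.memLp).2
  have j1 := ((memLp_muK_iff _).1 hf.memLp').2
  have jF : IntegrableOn (fun x => K x * f' x ^ 2 - κ * (K x * f x ^ 2)) (Ioi 0) :=
    j1.sub (j0.const_mul κ)
  have hint : ∫ x in Ioi (0 : ℝ), (K x * f' x ^ 2 - κ * (K x * f x ^ 2))
      = ∫ η, f' η ^ 2 ∂muK - κ * ∫ η, f η ^ 2 ∂muK := by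
    rw [integral_sub j1 (j0.const_mul κ), integral_const_mul, integral_muK, integral_muK]
  have hlim := intervalIntegral_tendsto_integral_Ioi 0 jF tendsto_id
  rw [hint] at hlim
  have hR : ∀ R, 0 ≤ R → -(R * (K R * f R ^ 2)) / 2 - f 0 ^ 2 * q 0
      ≤ ∫ x in (0 : ℝ)..R, (K x * f' x ^ 2 - κ * (K x * f x ^ 2)) := by
    intro R hR0
    have h1 : f R * f R * (K R * q R) - f 0 * f 0 * (K 0 * q 0)
        ≤ ∫ x in (0 : ℝ)..R, (K x * f' x ^ 2 - κ * (K x * f x ^ 2)) := by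
      rw [← hP.integral_eq_sub hR0]
      refine intervalIntegral.integral_mono_on hR0 (hP.intervalIntegrable hR0) ?_ ?_
      · rw [intervalIntegrable_iff_integrableOn_Ioc_of_le hR0]
        exact jF.mono_set Ioc_subset_Ioi_self
      · intro x hx
        -- Picone: K f'² - κ K f² - (K q f²)' = K (f' - q f)² ≥ 0.
        have := mul_nonneg (K_pos x).le (sq_nonneg (f' x - q x * f x))
        nlinarith
    have h2 : -(R / 2) ≤ q R := by
      rw [hq, le_div_iff₀ (hpos R hR0)]
      linarith [hlog R hR0]
    have h3 : f R * f R * (K R * (-(R / 2))) ≤ f R * f R * (K R * q R) :=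
      mul_le_mul_of_nonneg_left (mul_le_mul_of_nonneg_left h2 (K_pos R).le) (mul_self_nonneg _)
    rw [K_zero] at h1
    nlinarith
  by_contra hcon
  push Not at hcon
  set I := ∫ η, f' η ^ 2 ∂muK
  set J := ∫ η, f η ^ 2 ∂muK
  -- The defect ε is split in two: half bounds the tail of the integral, half the term R K f²/2 that
  -- q ≥ -R/2 leaves at a well-chosen R.
  set ε := (κ * J - (I + f 0 ^ 2 * (z' 0 / z 0))) with hε
  have hε0 : 0 < ε := by linarith
  have h1 := hlim.eventually (gt_mem_nhds (show I - κ * J < I - κ * J + ε / 2 by linarith))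
  obtain ⟨R, hR1, hR2, hR3⟩ := ((frequently_mul_lt_of_integrableOn j0 hε0).and_eventually
    (h1.and (eventually_ge_atTop 0))).exists
  have := hR R hR3
  simp only [id] at hR2
  have hq0 : q 0 = z' 0 / z 0 := rfl
  rw [hq0] at this
  linarith

/-! ### The weak formulation in terms of absolutely continuous representatives -/

theorem exists_isH1_of_mem_E {p : ℝ} {ω : L2K} (h : ω ∈ E p) :
    ∃ f f' : ℝ → ℝ, IsH1 f f' ∧ IsContRep ω f ∧ ∀ g g' : ℝ → ℝ, IsH1 g g' →
      ∫ η, f' η * g' η ∂muK - 1 / (2 * (p - 1)) * ∫ η, f η * g η ∂muK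
        + |f 0| ^ (p - 1) * f 0 * g 0 = 0 := by
  obtain ⟨-, dω, a, hd, ⟨f₀, hf₀, rfl⟩, hweak⟩ := h
  obtain ⟨f, hf, hf1⟩ := exists_isH1_of_isWeakDeriv hd
  refine ⟨f, dω, hf1, hf, fun g g' hg => ?_⟩
  have := hweak _ _ _ hg.isWeakDeriv ⟨g, hg.isContRep, rfl⟩
  rw [hf₀.apply_zero_eq hf] at this
  have i1 : Integrable (fun η => dω η * g' η) muK := hf1.memLp'.integrable_mul hg.memLp'
  have i2 : Integrable (fun η => f η * g η) muK := hf1.memLp.integrable_mul hg.memLp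
  refine Eq.trans ?_ this
  congr 1
  rw [← integral_const_mul, ← integral_sub i1 (i2.const_mul _)]
  refine integral_congr_ae ?_
  filter_upwards [hf.2, hg.memLp.coeFn_toLp, hg.memLp'.coeFn_toLp] with x h1 h2 h3
  rw [h1, h2, h3]

theorem IsH1.toLp_mem_E {p : ℝ} {f f' : ℝ → ℝ} (hf : IsH1 f f')
    (h : ∀ g g' : ℝ → ℝ, IsH1 g g' →
      ∫ η, f' η * g' η ∂muK - 1 / (2 * (p - 1)) * ∫ η, f η * g η ∂muK
        + |f 0| ^ (p - 1) * f 0 * g 0 = 0) :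
    hf.memLp.toLp f ∈ E p := by
  refine ⟨⟨_, hf.isWeakDeriv⟩, hf.memLp'.toLp f', f 0, hf.isWeakDeriv,
    ⟨f, hf.isContRep, rfl⟩, ?_⟩
  rintro ζ dζ b hζ ⟨g₀, hg₀, rfl⟩
  obtain ⟨g, hg, hg1⟩ := exists_isH1_of_isWeakDeriv hζ
  have i1 : Integrable (fun η => f' η * dζ η) muK := hf.memLp'.integrable_mul hg1.memLp'
  have i2 : Integrable (fun η => f η * g η) muK := hf.memLp.integrable_mul hg1.memLp
  rw [hg₀.apply_zero_eq hg]
  refine Eq.trans ?_ (h g dζ hg1)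
  congr 1
  rw [← integral_const_mul, ← integral_sub i1 (i2.const_mul _)]
  refine integral_congr_ae ?_
  filter_upwards [hg.2, hf.memLp.coeFn_toLp, hf.memLp'.coeFn_toLp] with x h1 h2 h3
  rw [h1, h2, h3]

/-! ### Integrals of parabolic cylinder type -/

/-- The integral `∫₀^∞ t^s exp (-t² - η t) dt`. -/
noncomputable def cylInt (s η : ℝ) : ℝ := ∫ t in Ioi (0 : ℝ), t ^ s * Real.exp (-t ^ 2 - η * t)

theorem integrableOn_rpow_mul_exp_half {s : ℝ} (hs : -1 < s) :
    IntegrableOn (fun t : ℝ => t ^ s * Real.exp (-(1 / 2) * t ^ 2)) (Ioi 0) :=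
  integrableOn_rpow_mul_exp_neg_mul_sq (by norm_num) hs

theorem measurable_cylIntegrand (s η : ℝ) :
    Measurable fun t : ℝ => t ^ s * Real.exp (-t ^ 2 - η * t) := by fun_prop

/-- From -ηt ≤ Mt ≤ t²/2 + M²/2. The bound is uniform for |η| ≤ M, as differentiation under the
integral requires. -/
theorem cylIntegrand_le {s η M t : ℝ} (hM : |η| ≤ M) (ht : 0 < t) :
    t ^ s * Real.exp (-t ^ 2 - η * t)
      ≤ Real.exp (M ^ 2 / 2) * (t ^ s * Real.exp (-(1 / 2) * t ^ 2)) := by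
  have h1 : Real.exp (-t ^ 2 - η * t) ≤ Real.exp (M ^ 2 / 2) * Real.exp (-(1 / 2) * t ^ 2) := by
    rw [← Real.exp_add]
    apply Real.exp_le_exp.2
    have := neg_abs_le η
    nlinarith [sq_nonneg (M - t)]
  calc _ ≤ t ^ s * (Real.exp (M ^ 2 / 2) * Real.exp (-(1 / 2) * t ^ 2)) :=
        mul_le_mul_of_nonneg_left h1 (Real.rpow_nonneg ht.le s)
    _ = _ := by ring

theorem integrableOn_cylIntegrand {s : ℝ} (hs : -1 < s) (η : ℝ) :
    IntegrableOn (fun t : ℝ => t ^ s * Real.exp (-t ^ 2 - η * t)) (Ioi 0) := by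
  refine ((integrableOn_rpow_mul_exp_half hs).const_mul (Real.exp (|η| ^ 2 / 2))).mono'
    (measurable_cylIntegrand s η).aestronglyMeasurable ?_
  filter_upwards [ae_restrict_mem measurableSet_Ioi] with t ht
  rw [Real.norm_of_nonneg (mul_nonneg (Real.rpow_nonneg (le_of_lt ht) s) (Real.exp_pos _).le)]
  exact cylIntegrand_le le_rfl ht

theorem cylInt_pos {s : ℝ} (hs : -1 < s) (η : ℝ) : 0 < cylInt s η := by
  refine (setIntegral_pos_iff_support_of_nonneg_ae ?_ (integrableOn_cylIntegrand hs η)).2 ?_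
  · filter_upwards [ae_restrict_mem measurableSet_Ioi] with t ht
    exact mul_nonneg (Real.rpow_nonneg (le_of_lt ht) s) (Real.exp_pos _).le
  · have : Ioi (0 : ℝ) ⊆ (Function.support fun t : ℝ => t ^ s * Real.exp (-t ^ 2 - η * t)) ∩ Ioi 0 :=
      fun t ht => ⟨(mul_pos (Real.rpow_pos_of_pos ht s) (Real.exp_pos _)).ne', ht⟩
    exact lt_of_lt_of_le (by simp) (measure_mono this)

theorem cylInt_anti {s : ℝ} (hs : -1 < s) : Antitone (cylInt s) := by
  intro a b hab
  refine setIntegral_mono_on (integrableOn_cylIntegrand hs b) (integrableOn_cylIntegrand hs a)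
    measurableSet_Ioi fun t ht => ?_
  have ht' : 0 < t := ht
  refine mul_le_mul_of_nonneg_left (Real.exp_le_exp.2 ?_) (Real.rpow_nonneg ht'.le s)
  nlinarith

theorem hasDerivAt_cylInt {s : ℝ} (hs : -1 < s) (η : ℝ) :
    HasDerivAt (cylInt s) (-cylInt (s + 1) η) η := by
  have hs1 : -1 < s + 1 := by linarith
  have h := hasDerivAt_integral_of_dominated_loc_of_deriv_le
    (μ := volume.restrict (Ioi (0 : ℝ))) (s := Metric.ball η 1) (x₀ := η)
    (F := fun η t => t ^ s * Real.exp (-t ^ 2 - η * t))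
    (F' := fun η t => -(t ^ (s + 1) * Real.exp (-t ^ 2 - η * t)))
    (bound := fun t => Real.exp ((|η| + 1) ^ 2 / 2) *
      (t ^ (s + 1) * Real.exp (-(1 / 2) * t ^ 2)))
    (Metric.ball_mem_nhds η one_pos)
    (Eventually.of_forall fun x => (measurable_cylIntegrand s x).aestronglyMeasurable)
    (integrableOn_cylIntegrand hs η)
    (measurable_cylIntegrand (s + 1) η).neg.aestronglyMeasurable
    (by
      filter_upwards [ae_restrict_mem measurableSet_Ioi] with t ht x hx
      rw [norm_neg, Real.norm_of_nonneg
        (mul_nonneg (Real.rpow_nonneg (le_of_lt ht) _) (Real.exp_pos _).le)]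
      refine cylIntegrand_le ?_ ht
      rw [Metric.mem_ball, Real.dist_eq] at hx
      linarith [abs_sub_abs_le_abs_sub x η])
    ((integrableOn_rpow_mul_exp_half hs1).const_mul _)
    (by
      filter_upwards [ae_restrict_mem measurableSet_Ioi] with t ht x _
      have ht' : 0 < t := ht
      have h1 : HasDerivAt (fun x : ℝ => -t ^ 2 - x * t) (-t) x := by
        simpa using ((hasDerivAt_id x).mul_const t).const_sub (-t ^ 2)
      convert! h1.exp.const_mul (t ^ s) using 1
      rw [Real.rpow_add_one ht'.ne']
      ring)
  have h2 := h.2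
  rw [integral_neg] at h2
  exact h2

/-- The derivative of t^(s+1) exp(-t² - ηt) has integral zero over (0, ∞). -/
theorem cylInt_recurrence {s : ℝ} (hs : -1 < s) (η : ℝ) :
    (s + 1) * cylInt s η = 2 * cylInt (s + 2) η + η * cylInt (s + 1) η := by
  have hs1 : -1 < s + 1 := by linarith
  have hs2 : -1 < s + 2 := by linarith
  have i0 := integrableOn_cylIntegrand hs η
  have i1 := integrableOn_cylIntegrand hs1 η
  have i2 := integrableOn_cylIntegrand hs2 η
  have hd : ∀ t ∈ Ioi (0 : ℝ), HasDerivAt (fun t : ℝ => t ^ (s + 1) * Real.exp (-t ^ 2 - η * t))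
      ((s + 1) * (t ^ s * Real.exp (-t ^ 2 - η * t))
        - (2 * (t ^ (s + 2) * Real.exp (-t ^ 2 - η * t))
        + η * (t ^ (s + 1) * Real.exp (-t ^ 2 - η * t)))) t := by
    intro t ht
    have ht' : 0 < t := ht
    have h1 := Real.hasDerivAt_rpow_const (x := t) (p := s + 1) (Or.inl ht'.ne')
    have h2 : HasDerivAt (fun t : ℝ => -t ^ 2 - η * t) (-(2 * t) - η) t := by
      convert! ((hasDerivAt_pow 2 t).neg).sub ((hasDerivAt_id t).const_mul η) using 1
      simp
    convert! h1.mul h2.exp using 1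
    rw [show s + 2 = s + 1 + 1 by ring, Real.rpow_add_one ht'.ne' (s + 1), add_sub_cancel_right]
    ring
  have hc : ContinuousWithinAt (fun t : ℝ => t ^ (s + 1) * Real.exp (-t ^ 2 - η * t))
      (Ici 0) 0 := by
    refine ContinuousAt.continuousWithinAt ?_
    refine (Real.continuousAt_rpow_const _ _ (Or.inr (by linarith))).mul ?_
    fun_prop
  have hlim : Tendsto (fun t : ℝ => t ^ (s + 1) * Real.exp (-t ^ 2 - η * t)) atTop (𝓝 0) := by
    have hi : IntegrableOn (fun t : ℝ => (s + 1) * (t ^ s * Real.exp (-t ^ 2 - η * t))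
        - (2 * (t ^ (s + 2) * Real.exp (-t ^ 2 - η * t))
        + η * (t ^ (s + 1) * Real.exp (-t ^ 2 - η * t)))) (Ioi 0) :=
      (i0.const_mul _).sub ((i2.const_mul _).add (i1.const_mul _))
    exact tendsto_zero_of_hasDerivAt_of_integrableOn_Ioi hd hi i1
  have := integral_Ioi_of_hasDerivAt_of_tendsto hc hd
    ((i0.const_mul _).sub ((i2.const_mul _).add (i1.const_mul _))) hlim
  have i3 : IntegrableOn (fun t : ℝ => 2 * (t ^ (s + 2) * Real.exp (-t ^ 2 - η * t))
      + η * (t ^ (s + 1) * Real.exp (-t ^ 2 - η * t))) (Ioi 0) :=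
    (i2.const_mul _).add (i1.const_mul _)
  rw [integral_sub (i0.const_mul _) i3,
    integral_add (i2.const_mul _) (i1.const_mul _), integral_const_mul, integral_const_mul,
    integral_const_mul, Real.zero_rpow (by linarith)] at this
  simp only [cylInt]
  linarith

theorem rpow_mul_cylInt {s η : ℝ} (hη : 0 < η) :
    η ^ (s + 1) * cylInt s η = ∫ t in Ioi (0 : ℝ), t ^ s * Real.exp (-(t / η) ^ 2 - t) := by
  have h := integral_comp_mul_left_Ioi (fun t : ℝ => t ^ s * Real.exp (-(t / η) ^ 2 - t)) 0 hη
  rw [mul_zero, smul_eq_mul] at h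
  have h2 : ∫ t in Ioi (0 : ℝ), (η * t) ^ s * Real.exp (-(η * t / η) ^ 2 - η * t)
      = η ^ s * cylInt s η := by
    rw [cylInt, ← integral_const_mul]
    refine setIntegral_congr_fun measurableSet_Ioi fun t ht => ?_
    have ht' : 0 < t := ht
    rw [Real.mul_rpow hη.le ht'.le, mul_div_cancel_left₀ _ hη.ne', mul_assoc]
  rw [h2] at h
  rw [Real.rpow_add_one hη.ne', mul_right_comm, h]
  field_simp

/-- After rescaling t by η, the exponent contains (t/η)², which lies between 0 and t² for η ≥ 1. The
two extremes give the Gamma integral and `cylInt s 1`. -/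
theorem cylInt_bounds {s : ℝ} (hs : -1 < s) {η : ℝ} (hη : 1 ≤ η) :
    cylInt s 1 ≤ η ^ (s + 1) * cylInt s η ∧ η ^ (s + 1) * cylInt s η ≤ Real.Gamma (s + 1) := by
  have hη0 : 0 < η := by linarith
  have hG : IntegrableOn (fun t : ℝ => Real.exp (-t) * t ^ (s + 1 - 1)) (Ioi 0) :=
    Real.GammaIntegral_convergent (by linarith)
  have hm : ∀ t ∈ Ioi (0 : ℝ), t ^ s * Real.exp (-(t / η) ^ 2 - t)
      ≤ Real.exp (-t) * t ^ (s + 1 - 1) := by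
    intro t ht
    rw [add_sub_cancel_right, mul_comm]
    refine mul_le_mul_of_nonneg_right (Real.exp_le_exp.2 ?_) (Real.rpow_nonneg (le_of_lt ht) _)
    nlinarith [sq_nonneg (t / η)]
  have hi : IntegrableOn (fun t : ℝ => t ^ s * Real.exp (-(t / η) ^ 2 - t)) (Ioi 0) := by
    refine hG.mono' (by fun_prop) ?_
    filter_upwards [ae_restrict_mem measurableSet_Ioi] with t ht
    rw [Real.norm_of_nonneg (mul_nonneg (Real.rpow_nonneg (le_of_lt ht) _) (Real.exp_pos _).le)]
    exact hm t ht
  rw [rpow_mul_cylInt hη0]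
  constructor
  · refine setIntegral_mono_on (integrableOn_cylIntegrand hs 1) hi measurableSet_Ioi fun t ht => ?_
    have ht' : 0 < t := ht
    refine mul_le_mul_of_nonneg_left (Real.exp_le_exp.2 ?_) (Real.rpow_nonneg ht'.le _)
    have h1 : t / η ≤ t := div_le_self ht'.le hη
    have h2 : 0 ≤ t / η := by positivity
    nlinarith
  · rw [Real.Gamma_eq_integral (by linarith)]
    exact setIntegral_mono_on hi hG measurableSet_Ioi hm

/-! ### Construction of decaying solutions -/

/-- Factoring out the Gaussian turns the equation into u'' = (x/2) u' - (κ - 1/2) u. Quadratic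
growth of u and of u' - (x/2) u is harmless, as the squared Gaussian beats K. -/
theorem IsDecayingSolution.of_gaussian_mul {κ C : ℝ} {u u' u'' : ℝ → ℝ}
    (h1 : ∀ x, HasDerivAt u (u' x) x) (h2 : ∀ x, HasDerivAt u' (u'' x) x)
    (hode : ∀ x, u'' x = x / 2 * u' x - (κ - 1 / 2) * u x)
    (hu : ∀ x, 0 < x → |u x| ≤ C * (1 + x ^ 2))
    (hu' : ∀ x, 0 < x → |u' x - x / 2 * u x| ≤ C * (1 + x ^ 2)) :
    IsDecayingSolution κ (fun x => u x * Real.exp (-x ^ 2 / 4))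
      (fun x => (u' x - x / 2 * u x) * Real.exp (-x ^ 2 / 4)) := by
  have he : ∀ x : ℝ, HasDerivAt (fun x : ℝ => Real.exp (-x ^ 2 / 4))
      (Real.exp (-x ^ 2 / 4) * (-(x / 2))) x := by
    intro x
    have : HasDerivAt (fun x : ℝ => -x ^ 2 / 4) (-(x / 2)) x := by
      convert! ((hasDerivAt_pow 2 x).neg.div_const 4) using 1
      ring
    exact this.exp
  have d1 : ∀ x, HasDerivAt (fun x => u x * Real.exp (-x ^ 2 / 4))
      ((u' x - x / 2 * u x) * Real.exp (-x ^ 2 / 4)) x := by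
    intro x
    convert! (h1 x).mul (he x) using 1
    ring
  have d2 : ∀ x, HasDerivAt (fun x => (u' x - x / 2 * u x) * Real.exp (-x ^ 2 / 4))
      (-(x / 2 * ((u' x - x / 2 * u x) * Real.exp (-x ^ 2 / 4)))
        - κ * (u x * Real.exp (-x ^ 2 / 4))) x := by
    intro x
    convert! ((h2 x).sub (((hasDerivAt_id x).div_const 2).mul (h1 x))).mul (he x) using 1
    simp only [id, hode, Pi.sub_apply, Pi.mul_apply]
    ring
  refine ⟨d1, d2, memLp_muK_of_bound (C := C) ?_ ?_, memLp_muK_of_bound (C := C) ?_ ?_⟩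
  · exact continuous_iff_continuousAt.2 fun x => (d1 x).continuousAt
  · intro x hx
    rw [abs_mul, Real.abs_exp]
    exact mul_le_mul_of_nonneg_right (hu x hx) (Real.exp_pos _).le
  · exact continuous_iff_continuousAt.2 fun x => (d2 x).continuousAt
  · intro x hx
    rw [abs_mul, Real.abs_exp]
    exact mul_le_mul_of_nonneg_right (hu' x hx) (Real.exp_pos _).le

theorem isDecayingSolution_gaussian :
    IsDecayingSolution (1 / 2) (fun x => 1 * Real.exp (-x ^ 2 / 4))
      (fun x => (0 - x / 2 * 1) * Real.exp (-x ^ 2 / 4)) := by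
  refine IsDecayingSolution.of_gaussian_mul (C := 1) (u := fun _ => 1) (u' := fun _ => 0)
    (u'' := fun _ => 0) (fun x => hasDerivAt_const x 1) (fun x => hasDerivAt_const x 0)
    (fun x => by ring) (fun x _ => ?_) (fun x hx => ?_)
  · rw [abs_one]; nlinarith
  · rw [abs_le]; constructor <;> nlinarith [sq_nonneg (x - 1)]

theorem isDecayingSolution_mul_gaussian :
    IsDecayingSolution 1 (fun x => x * Real.exp (-x ^ 2 / 4))
      (fun x => (1 - x / 2 * x) * Real.exp (-x ^ 2 / 4)) := by
  refine IsDecayingSolution.of_gaussian_mul (C := 1) (u := fun x => x) (u' := fun _ => 1)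
    (u'' := fun _ => 0) (fun x => hasDerivAt_id x) (fun x => hasDerivAt_const x 1)
    (fun x => by ring) (fun x hx => ?_) (fun x hx => ?_)
  · rw [abs_of_pos hx]; nlinarith [sq_nonneg (x - 1)]
  · rw [abs_le]; constructor <;> nlinarith [sq_nonneg (x - 1)]

theorem rpow_le_of_one_le {m η : ℝ} (hm0 : 0 < m) (hm1 : m < 1) (hη : 1 ≤ η) :
    (1 + η) ^ m ≤ 2 * η ^ m := by
  have h1 : (1 + η) ^ m ≤ (2 * η) ^ m :=
    Real.rpow_le_rpow (by linarith) (by linarith) hm0.le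
  rw [Real.mul_rpow (by norm_num) (by linarith)] at h1
  have h2 : (2 : ℝ) ^ m ≤ 2 := by
    simpa using Real.rpow_le_rpow_of_exponent_le (x := (2 : ℝ)) (by norm_num) hm1.le
  exact h1.trans (mul_le_mul_of_nonneg_right h2 (Real.rpow_nonneg (by linarith) _))

/-- For `1/2 < κ < 1`, the decaying solution is a positive multiple of `exp (-η²/4)` times
a function that grows like `η^(2κ-1)`. -/
theorem exists_pos_decayingSolution {κ : ℝ} (h1 : 1 / 2 < κ) (h2 : κ < 1) :
    ∃ z z' : ℝ → ℝ, IsDecayingSolution κ z z' ∧ (∀ x, 0 ≤ x → 0 < z x) ∧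
      (∀ x, 0 ≤ x → -(x / 2 * z x) ≤ z' x) ∧ 0 < z' 0 ∧
      ∃ c C : ℝ, 0 < c ∧ 0 < C ∧ ∀ x, 0 ≤ x → c * (1 + x) ^ (2 * κ - 1) ≤ K x * z x ∧
        K x * z x ≤ C * (1 + x) ^ (2 * κ - 1) := by
  obtain ⟨s, hs⟩ : ∃ s : ℝ, s = 1 - 2 * κ := ⟨_, rfl⟩
  have hs0 : -1 < s := by linarith
  have hs1 : -1 < s + 1 := by linarith
  have hsneg : s < 0 := by linarith
  set μ := κ - 1 / 2 with hμ
  have hμ0 : 0 < μ := by linarith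
  -- The natural solution `cylInt (-2κ)` diverges at t = 0, since -2κ < -1. By the recurrence it
  -- would formally be a multiple of this convergent u.
  set u : ℝ → ℝ := fun x => x / 2 * cylInt s x + cylInt (s + 1) x with hu
  have d1 : ∀ x, HasDerivAt u (μ * cylInt s x) x := by
    intro x
    convert! (((hasDerivAt_id x).div_const 2).mul (hasDerivAt_cylInt hs0 x)).add
      (hasDerivAt_cylInt hs1 x) using 1
    have := cylInt_recurrence hs0 x
    simp only [id]
    rw [show s + 1 + 1 = s + 2 by ring, hμ, show κ = (1 - s) / 2 by linarith]
    linarith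
  have d2 : ∀ x, HasDerivAt (fun x => μ * cylInt s x) (μ * -cylInt (s + 1) x) x :=
    fun x => (hasDerivAt_cylInt hs0 x).const_mul μ
  have pI0 := cylInt_pos hs0
  have pI1 := cylInt_pos hs1
  have upos : ∀ x, 0 ≤ x → 0 < u x := fun x hx =>
    add_pos_of_nonneg_of_pos (mul_nonneg (by linarith) (pI0 x).le) (pI1 x)
  have bI0 : ∀ x, 0 ≤ x → cylInt s x ≤ cylInt s 0 := fun x hx => cylInt_anti hs0 hx
  have bI1 : ∀ x, 0 ≤ x → cylInt (s + 1) x ≤ cylInt (s + 1) 0 := fun x hx => cylInt_anti hs1 hx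
  set A := cylInt s 0
  set B := cylInt (s + 1) 0
  have hA : 0 < A := pI0 0
  have hB : 0 < B := pI1 0
  have ubd : ∀ x, 0 ≤ x → u x ≤ x / 2 * A + B := fun x hx =>
    add_le_add (mul_le_mul_of_nonneg_left (bI0 x hx) (by linarith)) (bI1 x hx)
  have hsol := IsDecayingSolution.of_gaussian_mul (κ := κ) (C := A + B) (u := u) d1 d2
    (fun x => by simp only [hu]; ring)
    (fun x hx => by
      rw [abs_of_pos (upos x hx.le)]
      have := ubd x hx.le
      nlinarith [mul_nonneg hA.le (sq_nonneg (x - 1)), mul_nonneg hB.le (sq_nonneg x)])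
    (fun x hx => by
      have e1 := ubd x hx.le
      have e2 := upos x hx.le
      have e3 : μ * cylInt s x ≤ A := by
        have := bI0 x hx.le
        nlinarith [pI0 x]
      have e4 := mul_pos hμ0 (pI0 x)
      have e5 : x / 2 * u x ≤ x / 2 * (x / 2 * A + B) :=
        mul_le_mul_of_nonneg_left e1 (by linarith)
      have e6 : 0 < x / 2 * u x := mul_pos (by linarith) e2
      rw [abs_le]
      constructor <;>
      nlinarith [mul_nonneg hB.le (sq_nonneg (x - 1)), mul_nonneg hA.le (sq_nonneg x),
        mul_nonneg hB.le (sq_nonneg x)])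
  have hK : ∀ x, K x * (u x * Real.exp (-x ^ 2 / 4)) = u x := by
    intro x
    have : K x * Real.exp (-x ^ 2 / 4) = 1 := by
      rw [K, ← Real.exp_add, Real.exp_eq_one_iff]; ring
    linear_combination u x * this
  refine ⟨_, _, hsol, fun x hx => mul_pos (upos x hx) (Real.exp_pos _), fun x hx => ?_, ?_, ?_⟩
  · have e1 := mul_pos (mul_pos hμ0 (pI0 x)) (Real.exp_pos (-x ^ 2 / 4))
    linarith
  · simp only [zero_div, zero_mul, sub_zero]
    exact mul_pos (mul_pos hμ0 (pI0 0)) (Real.exp_pos _)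
  have hm0 : 0 < 2 * κ - 1 := by linarith
  have hm1 : 2 * κ - 1 < 1 := by linarith
  have hmono : MonotoneOn u (Ici 0) := by
    refine monotoneOn_of_deriv_nonneg (convex_Ici 0)
      (fun x _ => (d1 x).continuousAt.continuousWithinAt)
      (fun x _ => (d1 x).differentiableAt.differentiableWithinAt) fun x _ => ?_
    rw [(d1 x).deriv]
    exact (mul_pos hμ0 (pI0 x)).le
  have hu0 : u 0 = B := by simp [hu, B]
  set G := Real.Gamma (s + 1)
  have hG : 0 < G := Real.Gamma_pos_of_pos (by linarith)
  set D := cylInt s 1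
  have hD : 0 < D := pI0 1
  -- The dominant term of u is x `cylInt s x`/2, of order x^(-s) = x^(2κ-1).
  have large : ∀ x, 1 ≤ x → D / 2 * x ^ (2 * κ - 1) ≤ u x ∧ u x ≤ (G + B) * x ^ (2 * κ - 1) := by
    intro x hx
    have hx0 : 0 < x := by linarith
    obtain ⟨b1, b2⟩ := cylInt_bounds hs0 hx
    have e0 : x ^ (s + 1) * x ^ (2 * κ - 1) = x := by
      rw [← Real.rpow_add hx0, show s + 1 + (2 * κ - 1) = 1 by linarith, Real.rpow_one]
    have hxm : 1 ≤ x ^ (2 * κ - 1) := Real.one_le_rpow hx hm0.le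
    set y := x ^ (2 * κ - 1)
    have e1 : x * cylInt s x = y * (x ^ (s + 1) * cylInt s x) := by
      linear_combination (-cylInt s x) * e0
    have e2 := mul_le_mul_of_nonneg_left b1 (zero_le_one.trans hxm)
    have e3 := mul_le_mul_of_nonneg_left b2 (zero_le_one.trans hxm)
    rw [← e1] at e2 e3
    have e4 := bI1 x hx0.le
    have e5 := pI1 x
    simp only [hu]
    constructor <;> nlinarith
  refine ⟨min (B / 2) (D / 4), max (2 * A + 2 * B) (G + B), by positivity, by positivity,
    fun x hx => ?_⟩
  rw [hK]
  have hy : 1 ≤ (1 + x) ^ (2 * κ - 1) := Real.one_le_rpow (by linarith) hm0.le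
  rcases le_total x 1 with hx1 | hx1
  · have hy2 : (1 + x) ^ (2 * κ - 1) ≤ 2 := by
      calc (1 + x) ^ (2 * κ - 1) ≤ (1 + x) ^ (1 : ℝ) :=
            Real.rpow_le_rpow_of_exponent_le (by linarith) hm1.le
        _ ≤ 2 := by rw [Real.rpow_one]; linarith
    have e1 := hmono self_mem_Ici hx hx
    rw [hu0] at e1
    have e2 := ubd x hx
    have e3 : min (B / 2) (D / 4) ≤ B / 2 := min_le_left _ _
    have e4 : 2 * A + 2 * B ≤ max (2 * A + 2 * B) (G + B) := le_max_left _ _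
    constructor
    · nlinarith
    · nlinarith
  · obtain ⟨l1, l2⟩ := large x hx1
    have e1 := rpow_le_of_one_le hm0 hm1 hx1
    have e2 : x ^ (2 * κ - 1) ≤ (1 + x) ^ (2 * κ - 1) :=
      Real.rpow_le_rpow hx (by linarith) hm0.le
    have e3 : min (B / 2) (D / 4) ≤ D / 4 := min_le_right _ _
    have e4 : G + B ≤ max (2 * A + 2 * B) (G + B) := le_max_right _ _
    constructor
    · nlinarith
    · nlinarith

/-! ### Behaviour at infinity and uniqueness for the differential equation -/

theorem tendsto_rpow_mul_of_gaussian_bound {z : ℝ → ℝ} {m C : ℝ} (hm0 : 0 < m) (hm1 : m < 1)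
    (hpos : ∀ x, 0 ≤ x → 0 < z x) (hC : 0 < C)
    (h : ∀ x, 0 ≤ x → K x * z x ≤ C * (1 + x) ^ m) :
    Tendsto (fun x => x ^ (m + 1) * z x) atTop (𝓝 0) := by
  have hlim := (Real.tendsto_pow_mul_exp_neg_atTop_nhds_zero 3).const_mul (2 * C)
  rw [mul_zero] at hlim
  refine tendsto_of_tendsto_of_tendsto_of_le_of_le' tendsto_const_nhds hlim ?_ ?_
  · filter_upwards [eventually_ge_atTop 0] with x hx
    exact mul_nonneg (Real.rpow_nonneg hx _) (hpos x hx).le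
  -- For x ≥ 4 one has x ≤ x²/4, so exp x ≤ K x.
  · filter_upwards [eventually_ge_atTop 4] with x hx
    have hx0 : 0 < x := by linarith
    have e1 := h x hx0.le
    have e2 := rpow_le_of_one_le hm0 hm1 (show 1 ≤ x by linarith)
    have e3 : x ^ m ≤ x := by
      simpa using Real.rpow_le_rpow_of_exponent_le (show 1 ≤ x by linarith) hm1.le
    have e4 : x ^ (m + 1) ≤ x ^ 2 := by
      rw [Real.rpow_add_one hx0.ne', sq]
      exact mul_le_mul_of_nonneg_right e3 hx0.le
    have e5 : K x * z x ≤ 2 * C * x := by nlinarith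
    have e6 : Real.exp x * z x ≤ K x * z x := by
      refine mul_le_mul_of_nonneg_right (Real.exp_le_exp.2 ?_) (hpos x hx0.le).le
      nlinarith
    have e7 : z x ≤ 2 * C * x * Real.exp (-x) := by
      rw [Real.exp_neg, ← div_eq_mul_inv, le_div_iff₀ (Real.exp_pos x)]
      linarith
    calc x ^ (m + 1) * z x ≤ x ^ 2 * (2 * C * x * Real.exp (-x)) :=
          mul_le_mul e4 e7 (hpos x hx0.le).le (sq_nonneg x)
      _ = _ := by ring

/-- A solution that is `o(η^(-2κ))` at infinity is a multiple of the decaying solution. -/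
theorem IsDecayingSolution.eq_const_mul {κ c C : ℝ} {z z' : ℝ → ℝ}
    (hz : IsDecayingSolution κ z z') (h1 : 1 / 2 < κ) (h2 : κ < 1)
    (hpos : ∀ x, 0 ≤ x → 0 < z x) (hc : 0 < c) (hC : 0 < C)
    (hbd : ∀ x, 0 ≤ x → c * (1 + x) ^ (2 * κ - 1) ≤ K x * z x ∧
        K x * z x ≤ C * (1 + x) ^ (2 * κ - 1))
    {w w' w'' : ℝ → ℝ} (hw : ∀ x, 0 < x → HasDerivAt w (w' x) x)
    (hw' : ∀ x, 0 < x → HasDerivAt w' (w'' x) x)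
    (hode : ∀ x, 0 < x → w'' x = -(x / 2 * w' x) - κ * w x)
    (hlim : Tendsto (fun x => x ^ (2 * κ) * w x) atTop (𝓝 0)) :
    ∃ t : ℝ, ∀ x, 0 < x → w x = t * z x := by
  have hm0 : 0 < 2 * κ - 1 := by linarith
  have hm1 : 2 * κ - 1 < 1 := by linarith
  have hzlim : Tendsto (fun x => x ^ (2 * κ) * z x) atTop (𝓝 0) := by
    have := tendsto_rpow_mul_of_gaussian_bound hm0 hm1 hpos hC fun x hx => (hbd x hx).2
    simpa using this
  -- The weighted Wronskian is constant; call it D. Then (w/z)' = D/(K z²), and D = 0 gives the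
  -- claim.
  set Wr : ℝ → ℝ := fun x => K x * (w' x * z x - w x * z' x) with hWr
  have hWd : ∀ x, 0 < x → HasDerivAt Wr 0 x := by
    intro x hx
    convert! (hasDerivAt_K x).mul (((hw' x hx).mul (hz.hasDerivAt x)).sub
      ((hw x hx).mul (hz.hasDerivAt' x))) using 1
    simp only [Pi.sub_apply, Pi.mul_apply, hode x hx]
    ring
  obtain ⟨D, hD⟩ : ∃ D, ∀ x, 0 < x → Wr x = D := by
    refine ⟨Wr 1, fun x hx => ?_⟩
    exact isOpen_Ioi.is_const_of_deriv_eq_zero isPreconnected_Ioi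
      (fun y hy => (hWd y hy).differentiableAt.differentiableWithinAt)
      (fun y hy => (hWd y hy).deriv) hx (mem_Ioi.2 one_pos)
  have hr : ∀ x, 0 < x → HasDerivAt (fun x => w x / z x) (D * K x / (K x * z x) ^ 2) x := by
    intro x hx
    have hzx := (hpos x hx.le).ne'
    have hKx := (K_pos x).ne'
    convert! (hw x hx).div (hz.hasDerivAt x) hzx using 1
    rw [← hD x hx]
    simp only [hWr]
    field_simp
  by_cases hD0 : D = 0
  · refine ⟨w 1 / z 1, fun x hx => ?_⟩
    have : w x / z x = w 1 / z 1 :=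
      isOpen_Ioi.is_const_of_deriv_eq_zero (f := fun x => w x / z x) isPreconnected_Ioi
        (fun y hy => (hr y hy).differentiableAt.differentiableWithinAt)
        (fun y hy => by rw [(hr y hy).deriv, hD0, zero_mul, zero_div]; rfl) hx (mem_Ioi.2 one_pos)
    rw [← this, div_mul_cancel₀ _ (hpos x hx.le).ne']
  exfalso
  set m := 2 * κ - 1 with hm
  set c₁ : ℝ := 1 / (4 * C ^ 2) with hc₁
  have hc₁0 : 0 < c₁ := by positivity
  -- If D ≠ 0, the upper bound on K z gives (w/z)'/D ≥ c₁ K x^(-2m) for x ≥ 1. The subtracted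
  -- function has derivative at most that, so g is nondecreasing there.
  set g : ℝ → ℝ := fun x => w x / z x / D - 2 * c₁ * (K x * x ^ (-(2 * m) - 1)) with hg
  have hgd : ∀ x, 0 < x → HasDerivAt g (D * K x / (K x * z x) ^ 2 / D
      - 2 * c₁ * (x / 2 * K x * x ^ (-(2 * m) - 1)
        + K x * ((-(2 * m) - 1) * x ^ (-(2 * m) - 1 - 1)))) x := by
    intro x hx
    exact ((hr x hx).div_const D).sub (((hasDerivAt_K x).mul
      (Real.hasDerivAt_rpow_const (Or.inl hx.ne'))).const_mul (2 * c₁))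
  have hmono : MonotoneOn g (Ici 1) := by
    refine monotoneOn_of_deriv_nonneg (convex_Ici 1)
      (fun x hx => (hgd x (one_pos.trans_le hx)).continuousAt.continuousWithinAt)
      (fun x hx => ?_) fun x hx => ?_
    · rw [interior_Ici] at hx
      exact (hgd x (one_pos.trans hx)).differentiableAt.differentiableWithinAt
    · rw [interior_Ici] at hx
      have hx1 : 1 < x := hx
      have hx0 : 0 < x := one_pos.trans hx1
      rw [(hgd x hx0).deriv]
      have hu := (hbd x hx0.le).2
      have hu0 : 0 < K x * z x := mul_pos (K_pos x) (hpos x hx0.le)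
      have e1 := rpow_le_of_one_le hm0 hm1 hx1.le
      have e2 : K x * z x ≤ 2 * C * x ^ m := by nlinarith
      have e3 : (K x * z x) ^ 2 ≤ (2 * C * x ^ m) ^ 2 := pow_le_pow_left₀ hu0.le e2 2
      have e4 : x ^ (-(2 * m)) * (x ^ m) ^ 2 = 1 := by
        rw [← Real.rpow_natCast, ← Real.rpow_mul hx0.le, ← Real.rpow_add hx0]
        norm_num
        rw [show -(2 * m) + m * 2 = 0 by ring, Real.rpow_zero]
      have e5 : x * x ^ (-(2 * m) - 1) = x ^ (-(2 * m)) := by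
        rw [mul_comm, ← Real.rpow_add_one hx0.ne']; congr 1; ring
      have e6 : 0 < x ^ (-(2 * m)) := Real.rpow_pos_of_pos hx0 _
      have e7 : 0 < x ^ (-(2 * m) - 1 - 1) := Real.rpow_pos_of_pos hx0 _
      have e8 : c₁ * x ^ (-(2 * m)) ≤ 1 / (K x * z x) ^ 2 := by
        rw [le_div_iff₀ (by positivity)]
        calc c₁ * x ^ (-(2 * m)) * (K x * z x) ^ 2
            ≤ c₁ * x ^ (-(2 * m)) * (2 * C * x ^ m) ^ 2 :=
              mul_le_mul_of_nonneg_left e3 (by positivity)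
          _ = (4 * C ^ 2) * c₁ * (x ^ (-(2 * m)) * (x ^ m) ^ 2) := by ring
          _ = 1 := by rw [e4, hc₁, mul_one_div_cancel (by positivity), one_mul]
      have e9 : D * K x / (K x * z x) ^ 2 / D = K x * (1 / (K x * z x) ^ 2) := by
        field_simp
      have e10 : 2 * c₁ * (x / 2 * K x * x ^ (-(2 * m) - 1)
          + K x * ((-(2 * m) - 1) * x ^ (-(2 * m) - 1 - 1)))
          = K x * (c₁ * x ^ (-(2 * m))) - K x * (2 * c₁ * ((2 * m + 1) * x ^ (-(2 * m) - 1 - 1))) := by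
        rw [← e5]; ring
      rw [e9, e10]
      have e11 := mul_le_mul_of_nonneg_left e8 (K_pos x).le
      have e12 : 0 ≤ K x * (2 * c₁ * ((2 * m + 1) * x ^ (-(2 * m) - 1 - 1))) :=
        mul_nonneg (K_pos x).le (by positivity)
      linarith
  have hl1 := hlim.div_const D
  have hl2 := (hzlim.const_mul (g 1)).const_add (2 * c₁ * c)
  rw [zero_div] at hl1
  rw [mul_zero, add_zero] at hl2
  -- Multiply g(1) ≤ g(x) by x^(2κ) z. The w and z terms tend to 0, whereas the subtracted term
  -- becomes 2c₁ x^(-m) K z ≥ 2c₁c.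
  have hle : 2 * c₁ * c ≤ 0 := by
    refine le_of_tendsto_of_tendsto hl2 hl1 ?_
    filter_upwards [eventually_ge_atTop 1] with x hx
    have hx0 : 0 < x := by linarith
    have e1 := hmono self_mem_Ici hx hx
    have hzx := hpos x hx0.le
    have hq : 0 < x ^ (2 * κ) := Real.rpow_pos_of_pos hx0 _
    have e2 : g x * (x ^ (2 * κ) * z x) = x ^ (2 * κ) * w x / D
        - 2 * c₁ * (x ^ (2 * κ) * x ^ (-(2 * m) - 1)) * (K x * z x) := by
      simp only [hg]
      field_simp
    have e3 : x ^ (2 * κ) * x ^ (-(2 * m) - 1) = x ^ (-m) := by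
      rw [← Real.rpow_add hx0]; congr 1; rw [hm]; ring
    have e4 : c ≤ x ^ (-m) * (K x * z x) := by
      have f1 := (hbd x hx0.le).1
      have f2 : x ^ m ≤ (1 + x) ^ m := Real.rpow_le_rpow hx0.le (by linarith) hm0.le
      have f3 : x ^ (-m) * x ^ m = 1 := by
        rw [← Real.rpow_add hx0, neg_add_cancel, Real.rpow_zero]
      have f4 : 0 < x ^ (-m) := Real.rpow_pos_of_pos hx0 _
      calc c = x ^ (-m) * (c * x ^ m) := by linear_combination (-c) * f3
        _ ≤ _ := mul_le_mul_of_nonneg_left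
          ((mul_le_mul_of_nonneg_left f2 hc.le).trans f1) f4.le
    have e5 := mul_le_mul_of_nonneg_right e1 (mul_pos hq hzx).le
    rw [e2, e3] at e5
    have e6 := mul_le_mul_of_nonneg_left e4 (show 0 ≤ 2 * c₁ by positivity)
    linarith
  have : 0 < 2 * c₁ * c := by positivity
  linarith

/-! ### The Dirichlet inequality and the case p ≥ 2 -/

theorem IsH1.sub {f f' g g' : ℝ → ℝ} (hf : IsH1 f f') (hg : IsH1 g g') :
    IsH1 (fun x => f x - g x) (fun x => f' x - g' x) where
  ac R hR := (hf.ac R hR).sub (hg.ac R hR)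
  ae_hasDerivAt := by
    filter_upwards [hf.ae_hasDerivAt, hg.ae_hasDerivAt] with x h1 h2 using h1.sub h2
  memLp := hf.memLp.sub hg.memLp
  memLp' := hf.memLp'.sub hg.memLp'

/-- The first Dirichlet eigenvalue is at least `1`. -/
theorem IsH1.ae_eq_zero_of_integral_le {f f' : ℝ → ℝ} {κ : ℝ} (hf : IsH1 f f') (h0 : f 0 = 0)
    (hκ : κ < 1) (h : ∫ η, f' η ^ 2 ∂muK ≤ κ * ∫ η, f η ^ 2 ∂muK) : ∀ᵐ η ∂muK, f η = 0 := by
  -- The Dirichlet eigenfunction η exp(-η²/4) vanishes at 0 and cannot serve in Picone's identity. A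
  -- solution for some ν < 1 is positive up to 0, and ν > κ suffices.
  obtain ⟨ν, hν, hν1⟩ := exists_between (max_lt hκ (show (1 / 2 : ℝ) < 1 by norm_num))
  obtain ⟨hνκ, hν2⟩ := max_lt_iff.1 hν
  obtain ⟨z, z', hz, hpos, hlog, -, -⟩ := exists_pos_decayingSolution hν2 hν1
  have h1 := hf.mul_integral_sq_le hz hpos hlog
  rw [h0] at h1
  have hi : Integrable (fun η => f η ^ 2) muK := (memLp_two_iff_integrable_sq hf.memLp.1).1 hf.memLp
  have h2 : 0 ≤ ∫ η, f η ^ 2 ∂muK := integral_nonneg fun _ => sq_nonneg _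
  have h3 : ∫ η, f η ^ 2 ∂muK = 0 := by nlinarith
  rw [integral_eq_zero_iff_of_nonneg (fun _ => sq_nonneg _) hi] at h3
  filter_upwards [h3] with x hx
  exact pow_eq_zero_iff (two_ne_zero) |>.1 hx

theorem eq_zero_of_ae {ω : L2K} (h : ∀ᵐ η ∂muK, ω η = 0) : ω = 0 :=
  Lp.ext (EventuallyEq.trans h (Lp.coeFn_zero ℝ 2 muK).symm)

theorem isH1_zero : IsH1 (fun _ => 0) (fun _ => 0) where
  toACDeriv := ACDeriv.of_hasDerivAt (fun x _ => hasDerivAt_const x 0) continuousOn_const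
  memLp := MemLp.zero
  memLp' := MemLp.zero

theorem zero_mem_E (p : ℝ) : (0 : L2K) ∈ E p := by
  have h := isH1_zero.toLp_mem_E (p := p) fun g g' _ => by simp
  rwa [eq_zero_of_ae isH1_zero.memLp.coeFn_toLp] at h

theorem eq_zero_of_mem_E_of_two_le {p : ℝ} (hp : 2 ≤ p) {ω : L2K} (hω : ω ∈ E p) : ω = 0 := by
  obtain ⟨f, f', hf, hrep, hweak⟩ := exists_isH1_of_mem_E hω
  have hκ : 1 / (2 * (p - 1)) ≤ 1 / 2 := by
    apply one_div_le_one_div_of_le <;> linarith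
  set κ := 1 / (2 * (p - 1))
  have h1 := hweak f f' hf
  simp_rw [← sq] at h1
  have h2 := hf.mul_integral_sq_le isDecayingSolution_gaussian
    (fun x _ => mul_pos one_pos (Real.exp_pos _)) (fun x _ => le_of_eq (by ring))
  simp only [zero_div, zero_mul, sub_zero, mul_zero, add_zero] at h2
  have h3 : 0 ≤ ∫ η, f η ^ 2 ∂muK := integral_nonneg fun _ => sq_nonneg _
  -- Energy identity: ∫ f'² K + |f(0)|^(p+1) = κ ∫ f² K ≤ (1/2) ∫ f² K ≤ ∫ f'² K.
  have h0 : f 0 = 0 := by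
    by_contra hne
    have := mul_pos (mul_pos (Real.rpow_pos_of_pos (abs_pos.2 hne) (p - 1)) (abs_pos.2 hne))
      (abs_pos.2 hne)
    rw [mul_assoc, abs_mul_abs_self] at this
    nlinarith
  rw [h0] at h1
  have h4 := hf.ae_eq_zero_of_integral_le h0 (show κ < 1 by linarith) (by linarith)
  refine eq_zero_of_ae ?_
  filter_upwards [h4, hrep.2] with x hx hx'
  rw [hx', hx]

/-! ### The case p ≤ 3/2 and the multiples of the decaying solution -/

/-- Weak solutions tested against a decaying solution of the linear equation. -/
theorem weak_test_decayingSolution {p κ : ℝ} {f f' z z' : ℝ → ℝ} (hf : IsH1 f f')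
    (hweak : ∀ g g' : ℝ → ℝ, IsH1 g g' →
      ∫ η, f' η * g' η ∂muK - 1 / (2 * (p - 1)) * ∫ η, f η * g η ∂muK
        + |f 0| ^ (p - 1) * f 0 * g 0 = 0)
    (hz : IsDecayingSolution κ z z') :
    |f 0| ^ (p - 1) * f 0 * z 0 = (1 / (2 * (p - 1)) - κ) * ∫ η, f η * z η ∂muK + z' 0 * f 0 := by
  have h1 := hweak z z' hz.isH1
  have h2 := hf.integral_mul_decayingSolution hz
  linear_combination h1 - h2

theorem eq_zero_of_mem_EPlus {p : ℝ} (hp : 1 < p) (hp2 : p ≤ 3 / 2) {ω : L2K}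
    (hω : ω ∈ EPlus p) : ω = 0 := by
  obtain ⟨hω, hnn⟩ := hω
  obtain ⟨f, f', hf, hrep, hweak⟩ := exists_isH1_of_mem_E hω
  have hκ : 1 ≤ 1 / (2 * (p - 1)) := by
    rw [le_div_iff₀ (by linarith)]; linarith
  have t1 := weak_test_decayingSolution hf hweak isDecayingSolution_gaussian
  have t2 := weak_test_decayingSolution hf hweak isDecayingSolution_mul_gaussian
  set κ := 1 / (2 * (p - 1))
  have hfnn : ∀ᵐ η ∂muK, 0 ≤ f η := by
    filter_upwards [hnn, hrep.2] with x h1 h2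
    rwa [← h2]
  have n1 : 0 ≤ᵐ[muK] fun η => f η * (1 * Real.exp (-η ^ 2 / 4)) := by
    filter_upwards [hfnn] with x hx
    exact mul_nonneg hx (by positivity)
  have n2 : 0 ≤ ∫ η, f η * (η * Real.exp (-η ^ 2 / 4)) ∂muK := by
    refine integral_nonneg_of_ae ?_
    have hmem : ∀ᵐ η ∂muK, 0 < η := by
      rw [ae_muK]; exact ae_restrict_mem measurableSet_Ioi
    filter_upwards [hfnn, hmem] with x hx hx0
    exact mul_nonneg hx (by positivity)
  have n3 := integral_nonneg_of_ae n1
  have i1 : Integrable (fun η => f η * (1 * Real.exp (-η ^ 2 / 4))) muK :=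
    hf.memLp.integrable_mul isDecayingSolution_gaussian.memLp
  set J₁ := ∫ η, f η * (1 * Real.exp (-η ^ 2 / 4)) ∂muK with hJ₁
  set J₂ := ∫ η, f η * (η * Real.exp (-η ^ 2 / 4)) ∂muK
  simp only [zero_div, zero_mul, mul_zero, sub_zero, ne_eq, OfNat.ofNat_ne_zero,
    not_false_eq_true, zero_pow, neg_zero, Real.exp_zero, mul_one, add_zero, one_mul] at t1 t2
  -- With J₁, J₂ ≥ 0, the two tests read |f(0)|^(p-1) f(0) = (κ - 1/2) J₁ and 0 = (κ - 1) J₂ + f(0).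
  have ha1 : f 0 ≤ 0 := by nlinarith
  have ha : |f 0| ^ (p - 1) * f 0 ≤ 0 :=
    mul_nonpos_of_nonneg_of_nonpos (Real.rpow_nonneg (abs_nonneg _) _) ha1
  have hJ0 : J₁ = 0 := by nlinarith
  have h0 := (integral_eq_zero_iff_of_nonneg_ae n1 i1).1 hJ0
  refine eq_zero_of_ae ?_
  filter_upwards [h0, hrep.2] with x hx hx'
  rw [hx']
  simpa using hx

theorem IsDecayingSolution.toLp_mem_E {p : ℝ} {z z' : ℝ → ℝ}
    (hz : IsDecayingSolution (1 / (2 * (p - 1))) z z') (h : |z 0| ^ (p - 1) * z 0 = z' 0) :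
    hz.memLp.toLp z ∈ E p := by
  refine hz.isH1.toLp_mem_E fun g g' hg => ?_
  have := hg.integral_mul_decayingSolution hz
  simp_rw [mul_comm (z' _) (g' _), mul_comm (z _) (g _)]
  rw [this, h]
  ring

/-- Subtracting the multiple of z with the same trace leaves a function that vanishes at 0 and
satisfies ∫ h'² K = κ ∫ h² K. As κ < 1, the Dirichlet inequality makes it zero. -/
theorem ae_eq_mul_of_weak {p : ℝ} {f f' z z' : ℝ → ℝ} (hκ1 : 1 / (2 * (p - 1)) < 1)
    (hf : IsH1 f f')
    (hweak : ∀ g g' : ℝ → ℝ, IsH1 g g' →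
      ∫ η, f' η * g' η ∂muK - 1 / (2 * (p - 1)) * ∫ η, f η * g η ∂muK
        + |f 0| ^ (p - 1) * f 0 * g 0 = 0)
    (hz : IsDecayingSolution (1 / (2 * (p - 1))) z z') (hz0 : 0 < z 0) :
    ∀ᵐ η ∂muK, f η = f 0 / z 0 * z η := by
  have t1 := weak_test_decayingSolution hf hweak hz
  have t2 := hweak f f' hf
  have t3 := hf.integral_mul_decayingSolution hz
  have t4 := hz.isH1.integral_mul_decayingSolution hz
  set κ := 1 / (2 * (p - 1))
  set t := f 0 / z 0
  have hft : f 0 = t * z 0 := (div_mul_cancel₀ _ hz0.ne').symm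
  have htz := hz.const_mul t
  have hh := hf.sub htz.isH1
  have expand : ∀ {a b : ℝ → ℝ}, MemLp a 2 muK → MemLp b 2 muK →
      ∫ η, (a η - t * b η) ^ 2 ∂muK = ∫ η, a η * a η ∂muK - 2 * t * ∫ η, a η * b η ∂muK
        + t ^ 2 * ∫ η, b η * b η ∂muK := by
    intro a b ha hb
    have i1 : Integrable (fun η => a η * a η) muK := ha.integrable_mul ha
    have i2 : Integrable (fun η => a η * b η) muK := ha.integrable_mul hb
    have i3 : Integrable (fun η => b η * b η) muK := hb.integrable_mul hb
    have i4 : Integrable (fun η => a η * a η - 2 * t * (a η * b η)) muK := i1.sub (i2.const_mul _)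
    rw [← integral_const_mul, ← integral_const_mul, ← integral_sub i1 (i2.const_mul _),
      ← integral_add i4 (i3.const_mul _)]
    congr 1; funext η; ring
  have key := hh.ae_eq_zero_of_integral_le (by simp only [hft, sub_self]) hκ1 (by
    rw [expand hf.memLp' hz.memLp', expand hf.memLp hz.memLp, t3, t4]
    rw [sub_self, zero_mul, zero_add] at t1
    rw [hft] at t1 t2 ⊢
    have t5 := mul_right_cancel₀ hz0.ne' (show |t * z 0| ^ (p - 1) * (t * z 0) * z 0
      = z' 0 * t * z 0 by linear_combination t1)
    rw [t5] at t2
    refine le_of_eq ?_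
    linear_combination t2)
  filter_upwards [key] with x hx
  linarith

/-- The decay exponent 1/(p-1) is 2κ, so the Wronskian argument applies on the open half-line.
Continuity and uniqueness of the one-sided derivative carry the result to the boundary condition. -/
theorem IsClassicalSolution.eq_const_mul {p c C : ℝ} {z z' v : ℝ → ℝ} (hp : 1 < p)
    (hz : IsDecayingSolution (1 / (2 * (p - 1))) z z') (h1 : 1 / 2 < 1 / (2 * (p - 1)))
    (h2 : 1 / (2 * (p - 1)) < 1)
    (hpos : ∀ x, 0 ≤ x → 0 < z x) (hc : 0 < c) (hC : 0 < C)
    (hbd : ∀ x, 0 ≤ x → c * (1 + x) ^ (2 * (1 / (2 * (p - 1))) - 1) ≤ K x * z x ∧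
        K x * z x ≤ C * (1 + x) ^ (2 * (1 / (2 * (p - 1))) - 1))
    (hv : IsClassicalSolution p v) :
    ∃ t : ℝ, (∀ x, 0 ≤ x → v x = t * z x) ∧ |v 0| ^ (p - 1) * v 0 = t * z' 0 := by
  obtain ⟨dw, ddw, hd, hdd, hode, hbc, hlim⟩ := hv
  have hexp : 1 / (p - 1) = 2 * (1 / (2 * (p - 1))) := by
    have : p - 1 ≠ 0 := by linarith
    field_simp
  rw [hexp] at hlim
  obtain ⟨t, ht⟩ := hz.eq_const_mul h1 h2 hpos hc hC hbd
    (fun x hx => (hd x hx.le).hasDerivAt (Ici_mem_nhds hx)) hdd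
    (fun x hx => by linarith [hode x hx]) hlim
  have hz0 := hz.hasDerivAt 0
  have ht0 : v 0 = t * z 0 := by
    have l1 := ((hd 0 le_rfl).continuousWithinAt).mono_left
      (nhdsWithin_mono 0 Ioi_subset_Ici_self)
    have l2 : Tendsto (fun x => t * z x) (𝓝[>] 0) (𝓝 (t * z 0)) :=
      ((hz0.const_mul t).continuousAt).mono_left nhdsWithin_le_nhds
    refine tendsto_nhds_unique l1 (l2.congr' ?_)
    filter_upwards [self_mem_nhdsWithin] with x hx using (ht x hx).symm
  have hall : ∀ x, 0 ≤ x → v x = t * z x := fun x hx => by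
    rcases hx.eq_or_lt with rfl | h
    · exact ht0
    · exact ht x h
  refine ⟨t, hall, ?_⟩
  have l3 : HasDerivWithinAt v (t * z' 0) (Ici 0) 0 :=
    ((hz0.const_mul t).hasDerivWithinAt).congr (fun x hx => hall x hx) ht0
  rw [(uniqueDiffWithinAt_Ici (0 : ℝ)).eq_deriv _ l3 (hd 0 le_rfl)]
  linarith

end SelfSimilar

/-! ### The main theorem -/

theorem mainTheorem1 (p : ℝ) (hp : 1 < p) :
    (2 ≤ p → SelfSimilar.E p = {0}) ∧
    (p ≤ 3 / 2 → SelfSimilar.EPlus p = {0}) ∧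
    (3 / 2 < p → p < 2 →
      ∃ (W : SelfSimilar.L2K) (ωs : ℝ → ℝ),
        SelfSimilar.IsContRep W ωs ∧
        SelfSimilar.E p = {W, -W, 0} ∧
        (∀ η : ℝ, 0 ≤ η → 0 < ωs η) ∧
        (∀ u ∈ SelfSimilar.E p, (∀ᵐ η ∂SelfSimilar.muK, 0 < u η) → u = W) ∧
        SelfSimilar.IsClassicalSolution p ωs ∧
        (∀ v : ℝ → ℝ, SelfSimilar.IsClassicalSolution p v → (∀ η : ℝ, 0 < η → 0 < v η) →
          ∀ η : ℝ, 0 ≤ η → v η = ωs η) ∧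
        ∃ c : ℝ, 1 < c ∧ ∀ η : ℝ, 0 < η →
          c⁻¹ * (1 + η) ^ (1 / (p - 1) - 1) ≤ Real.exp (η ^ 2 / 4) * ωs η ∧
          Real.exp (η ^ 2 / 4) * ωs η ≤ c * (1 + η) ^ (1 / (p - 1) - 1)) := by
  open SelfSimilar in
  refine ⟨fun h => ?_, fun h => ?_, fun h3 h4 => ?_⟩
  · exact Subset.antisymm (fun ω hω => eq_zero_of_mem_E_of_two_le h hω)
      (singleton_subset_iff.2 (zero_mem_E p))
  · refine Subset.antisymm (fun ω hω => eq_zero_of_mem_EPlus hp h hω)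
      (singleton_subset_iff.2 ⟨zero_mem_E p, ?_⟩)
    filter_upwards [Lp.coeFn_zero ℝ 2 muK] with x hx
    rw [hx]; rfl
  have hp1 : p - 1 ≠ 0 := by linarith
  have hκ0 : 1 / 2 < 1 / (2 * (p - 1)) :=
    one_div_lt_one_div_of_lt (by linarith) (by linarith)
  have hκ1 : 1 / (2 * (p - 1)) < 1 := by
    rw [div_lt_one (by linarith)]; linarith
  have hexp : 2 * (1 / (2 * (p - 1))) = 1 / (p - 1) := by field_simp
  obtain ⟨z, z', hz, hpos, -, hz'0, c, C, hc, hC, hbd⟩ := exists_pos_decayingSolution hκ0 hκ1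
  have hz0 := hpos 0 le_rfl
  obtain ⟨A, hA0, hA⟩ : ∃ A : ℝ, 0 < A ∧ ∀ y : ℝ, 0 < y → (y ^ (p - 1) = z' 0 / z 0 ↔ y = A) := by
    have hm : 0 < z' 0 / z 0 := div_pos hz'0 hz0
    refine ⟨(z' 0 / z 0) ^ (p - 1)⁻¹, Real.rpow_pos_of_pos hm _, fun y hy => ?_⟩
    rw [Real.eq_rpow_inv hy.le hm.le hp1]
  -- For t ≠ 0 the boundary condition becomes |t z(0)|^(p-1) = z'(0)/z(0) > 0, so |t| z(0) equals
  -- the root A.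
  have hiff : ∀ t : ℝ, |t * z 0| ^ (p - 1) * (t * z 0) = t * z' 0 ↔
      t = A / z 0 ∨ t = -(A / z 0) ∨ t = 0 := by
    intro t
    by_cases ht : t = 0
    · simp [ht]
    have habs : 0 < |t * z 0| := abs_pos.2 (mul_ne_zero ht hz0.ne')
    have e1 : |t * z 0| ^ (p - 1) * (t * z 0) = t * z' 0 ↔ |t * z 0| ^ (p - 1) = z' 0 / z 0 := by
      rw [eq_div_iff hz0.ne', ← mul_right_inj' ht (b := |t * z 0| ^ (p - 1) * z 0)]
      constructor <;> intro h <;> linear_combination h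
    rw [e1, hA _ habs, abs_eq hA0.le, eq_div_iff hz0.ne', ← neg_div, eq_div_iff hz0.ne']
    simp [ht]
  set s := A / z 0 with hs
  have hs0 : 0 < s := div_pos hA0 hz0
  have hsz := hz.const_mul s
  have hmemE : ∀ t : ℝ, t = s ∨ t = -s ∨ t = 0 → (hz.const_mul t).memLp.toLp _ ∈ E p :=
    fun t ht => (hz.const_mul t).toLp_mem_E ((hiff t).2 ht)
  have hneg : (hz.const_mul (-s)).memLp.toLp _ = -hsz.memLp.toLp _ := by
    rw [← MemLp.toLp_neg]
    refine MemLp.toLp_congr _ _ (ae_of_all _ fun x => ?_)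
    simp
  have hE : E p = {hsz.memLp.toLp _, -hsz.memLp.toLp _, 0} := by
    refine Subset.antisymm (fun ω hω => ?_) ?_
    · obtain ⟨f, f', hf, hrep, hweak⟩ := exists_isH1_of_mem_E hω
      have h1 := ae_eq_mul_of_weak hκ1 hf hweak hz hz0
      have h2 := weak_test_decayingSolution hf hweak hz
      set t := f 0 / z 0
      have hft : f 0 = t * z 0 := (div_mul_cancel₀ _ hz0.ne').symm
      rw [sub_self, zero_mul, zero_add, hft] at h2
      have h3 := (hiff t).1 (mul_right_cancel₀ hz0.ne' (h2.trans (by ring)))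
      have h4 : ω = (hz.const_mul t).memLp.toLp _ := by
        apply Lp.ext
        filter_upwards [h1, hrep.2, (hz.const_mul t).memLp.coeFn_toLp] with x e1 e2 e3
        rw [e3, e2, e1]
      rcases h3 with h3 | h3 | h3
      · left; rw [h4]; congr 1; simp only [h3]
      · right; left
        rw [← hneg, h4]; congr 1; simp only [h3]
      · right; right
        refine eq_zero_of_ae ?_
        filter_upwards [h1, hrep.2] with x e1 e2
        rw [e2, e1, h3, zero_mul]
    · rintro ω (rfl | rfl | rfl)
      · exact hmemE s (Or.inl rfl)
      · rw [← hneg]; exact hmemE (-s) (Or.inr (Or.inl rfl))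
      · exact zero_mem_E p
  have hspos : ∀ η : ℝ, 0 ≤ η → 0 < s * z η := fun η hη => mul_pos hs0 (hpos η hη)
  -- Nontriviality of the measure lets almost everywhere positivity exclude -W and 0 by evaluation
  -- at a single point.
  have hne : (ae muK).NeBot := by
    rw [ae_muK, ae_neBot]
    intro h0
    have := Measure.restrict_eq_zero.1 h0
    simp at this
  refine ⟨hsz.memLp.toLp _, fun η => s * z η, hsz.isH1.isContRep, hE, hspos, ?_, ?_, ?_, ?_⟩
  · intro u hu hupos
    rw [hE] at hu
    rcases hu with rfl | rfl | rfl
    · rfl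
    · exfalso
      have hmem : ∀ᵐ η ∂muK, 0 < η := by
        rw [ae_muK]; exact ae_restrict_mem measurableSet_Ioi
      obtain ⟨x, e1, e2, e3, e4⟩ := (hupos.and ((Lp.coeFn_neg (hsz.memLp.toLp _)).and
        (hsz.memLp.coeFn_toLp.and hmem))).exists
      rw [e2, Pi.neg_apply, e3] at e1
      linarith [hspos x e4.le]
    · exfalso
      obtain ⟨x, e1, e2⟩ := (hupos.and (Lp.coeFn_zero ℝ 2 muK)).exists
      rw [e2] at e1
      exact lt_irrefl _ e1
  · refine ⟨_, _, fun η _ => (hsz.hasDerivAt η).hasDerivWithinAt, fun η _ => hsz.hasDerivAt' η,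
      fun η _ => by ring, ?_, ?_⟩
    · rw [(hiff s).2 (Or.inl rfl)]; ring
    · have h1 := tendsto_rpow_mul_of_gaussian_bound (by linarith) (by linarith) hpos hC
        fun x hx => (hbd x hx).2
      rw [sub_add_cancel, hexp] at h1
      have h2 := h1.const_mul s
      rw [mul_zero] at h2
      exact h2.congr fun x => by ring
  · intro v hv hvpos
    obtain ⟨t, ht, ht0⟩ := hv.eq_const_mul hp hz hκ0 hκ1 hpos hc hC hbd
    have htpos : 0 < t := by
      have := hvpos 1 one_pos
      rw [ht 1 zero_le_one] at this
      exact (pos_iff_pos_of_mul_pos this).2 (hpos 1 zero_le_one)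
    rw [ht 0 le_rfl] at ht0
    rcases (hiff t).1 ht0 with rfl | rfl | rfl
    · exact ht
    · linarith
    · exact absurd htpos (lt_irrefl _)
  · rw [hexp] at hbd
    -- The 2 only secures c > 1; the other two entries give the upper and lower bounds.
    refine ⟨max 2 (max (s * C) (s * c)⁻¹), lt_of_lt_of_le one_lt_two (le_max_left _ _),
      fun η hη => ?_⟩
    obtain ⟨b1, b2⟩ := hbd η hη.le
    have hy : 0 ≤ (1 + η) ^ (1 / (p - 1) - 1) := Real.rpow_nonneg (by linarith) _
    have e0 : Real.exp (η ^ 2 / 4) * (s * z η) = s * (K η * z η) := by rw [K]; ring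
    have e1 : (max 2 (max (s * C) (s * c)⁻¹))⁻¹ ≤ s * c :=
      inv_le_of_inv_le₀ (mul_pos hs0 hc) ((le_max_right _ _).trans (le_max_right _ _))
    have e2 : s * C ≤ max 2 (max (s * C) (s * c)⁻¹) := (le_max_left _ _).trans (le_max_right _ _)
    rw [e0]
    constructor
    · refine (mul_le_mul_of_nonneg_right e1 hy).trans ?_
      rw [mul_assoc]
      exact mul_le_mul_of_nonneg_left b1 hs0.le
    · refine le_trans ?_ (mul_le_mul_of_nonneg_right e2 hy)
      rw [mul_assoc]
      exact mul_le_mul_of_nonneg_left b2 hs0.le
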